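/- Let $f=(f_1,\dots,f_m)$ be polynomials in $\mathbb{Q}[y][x]$, with parameters $y=(y_1,\dots,y_t)$ and variables $x=(x_1,\dots,x_n)$. Assume (A) there is a non-empty Zariski open subset $\mathcal{O}\subset\mathbb{C}^t$ such that for every $\eta\in\mathcal{O}$ the set of complex zeros of $f(\eta,\cdot)$ is non-empty and finite, and assume that the ideal $\langle f\rangle\subset\mathbb{Q}[x,y]$ is radical. Notation. Let $\mathcal{G}$ be the reduced Gröbner basis of $\langle f\rangle$ for the elimination order $\mathrm{grevlex}(x)\succ\mathrm{grevlex}(y)$. For $g\in\mathcal{G}$ let $\mathrm{lm}_x(g)$ and $\mathrm{lc}_x(g)\in\mathbb{Q}[y]$ be the leading monomial and leading coefficient of $g\in\mathbb{Q}[y][x]$ for $\mathrm{grevlex}(x)$. Let $\mathcal{W}_\infty\subset\mathbb{R}^t$ be the set of the $\eta$ at which some $\mathrm{lc}_x(g)$, $g\in\mathcal{G}$, vanishes, and let $w_\infty$ be the square-free part of $\mathrm{lcm}_{g\in\mathcal{G}}\mathrm{lc}_x(g)$. Let $\mathcal{B}$ be the set of monomials in $x$ divisible by no $\mathrm{lm}_x(g)$,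 $g\in\mathcal{G}$. Let $\mathbb{K}=\mathbb{Q}(y)$. If $\mathcal{B}=\{b_1,\dots,b_\delta\}$ is finite, let $\mathcal{H}=(\mathrm{trace}(\mathcal{L}_{b_ib_j}))_{1\le i,j\le\delta}$, where $\mathcal{L}_p$ is multiplication by $p$ on $\mathbb{K}[x]/\langle f\rangle_{\mathbb{K}}$, and for $A\in\mathrm{GL}_\delta(\mathbb{Q})$ let $M_1,\dots,M_\delta\in\mathbb{K}$ be the leading principal minors of $\mathcal{H}_A=A^{T}\mathcal{H}A$. Then $\mathcal{B}$ is finite, and for every enumeration $b_1,\dots,b_\delta$ of $\mathcal{B}$: 1. The set of those $A\in\mathrm{GL}_\delta(\mathbb{Q})$ for which none of $M_1,\dots,M_\delta$ is identically zero is Zariski dense in $\mathrm{GL}_\delta(\mathbb{Q})$. 2. Let $A\in\mathrm{GL}_\delta(\mathbb{Q})$ be such that none of $M_1,\dots,M_\delta$ is identically zero. Let $\mathcal{S}\subset\mathbb{R}^t$ be the set of points at which all the rational functions $M_i$ are defined and non-zero. For each connected component $\mathcal{S}'$ of $\mathcal{S}$, the number of real zeros of $f(\eta,\cdot)$ is finite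 and is the same for all $\eta\in\mathcal{S}'\setminus\mathcal{W}_\infty$. 3. For such an $A$, Algorithm RRC-Hermite solves the real root classification problem for $f$. The algorithm computes a finite set $L\subset\mathbb{Q}^t$ of points of $U=\{\eta\in\mathbb{R}^t: w_\infty(\eta)\neq0,\ M_1(\eta)\ne0,\dots,M_\delta(\eta)\neq0\}$ that meets every connected component of $U$, and returns, for each $\eta\in L$, the triple $(\Phi_\eta,\eta,r_\eta)$, where $\Phi_\eta$ is the semi-algebraic formula "$w_\infty\neq0$ and $\mathrm{sign}\,M_i=\mathrm{sign}\,M_i(\eta)$ for $1\le i\le\delta$" and $r_\eta$ is the signature of $\mathcal{H}(\eta)$. Such an $L$ exists, and for every such $L$ the output is a finite family of triples with the following properties: if $\mathcal{S}_\eta\subset\mathbb{R}^t$ is the set defined by $\Phi_\eta$, then the number of real zeros of $f(\eta',\cdot)$ is the same for all $\eta'\in\mathcal{S}_\eta$; $\eta\in\mathcal{S}_\eta$, and $r_\eta$ is the (finite) number of real zeros of $f(\eta,\cdot)$; and the union of the sets $\mathcal{S}_\eta$, $\eta\in L$, is dense in $\mathbb{R}^t$. -/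

import Mathlib

namespace RRC

open MvPolynomial

/-! ### Monomial orders -/

/-- The monomial order obtained by pulling back a well-ordered additive monoid along an injective
additive map with nonnegative values. -/
noncomputable def pullbackOrder {σ M : Type} [AddCommMonoid M] [LinearOrder M]
    [IsOrderedAddMonoid M] [WellFoundedLT M] (φ : (σ →₀ ℕ) →+ M)
    (hφ : Function.Injective φ) (h0 : ∀ a, 0 ≤ φ a) : MonomialOrder σ where
  syn := AddMonoidHom.mrange φ
  addCommMonoidSyn := inferInstance
  linearOrderSyn := inferInstance
  isOrderedAddMonoid_syn := inferInstance
  wellFoundedLT_syn := inferInstance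
  toSyn := AddEquiv.ofBijective φ.mrangeRestrict
    ⟨fun a b h => hφ (congrArg Subtype.val h), φ.mrangeRestrict_surjective⟩
  toSyn_monotone := by
    intro a b hab
    obtain ⟨c, rfl⟩ := le_iff_exists_add.mp hab
    change φ a ≤ φ (a + c)
    rw [map_add]
    exact le_add_of_nonneg_right (h0 c)

/-- The partial sum `a₁ + ⋯ + aᵢ`. -/
def psum {n : ℕ} (a : Fin n →₀ ℕ) (i : Fin n) : ℕ := ∑ j ∈ Finset.Iic i, a j

/-- `a ↦ (a₁ + ⋯ + aₙ, a₁ + ⋯ + aₙ₋₁, …, a₁)`; comparing these vectors lexicographically is the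
graded reverse lexicographical order (see `grevlex_lt_iff`). -/
def grevlexWeight (n : ℕ) : (Fin n →₀ ℕ) →+ Lex (Fin n → ℕ) where
  toFun a := toLex fun i => psum a (Fin.rev i)
  map_zero' := by
    apply toLex.symm.injective; funext i; exact Finset.sum_eq_zero fun _ _ => rfl
  map_add' a b := by
    apply toLex.symm.injective; funext i; exact Finset.sum_add_distrib

lemma grevlexWeight_lt_iff {n : ℕ} (a b : Fin n →₀ ℕ) :
    grevlexWeight n a < grevlexWeight n b ↔
      a.degree < b.degree ∨
        (a.degree = b.degree ∧ ∃ i, b i < a i ∧ ∀ j, i < j → a j = b j) := by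
  have hlt : grevlexWeight n a < grevlexWeight n b ↔
      ∃ i : Fin n, (∀ j, j < i → psum a (Fin.rev j) = psum b (Fin.rev j)) ∧
        psum a (Fin.rev i) < psum b (Fin.rev i) := Iff.rfl
  rw [hlt]
  cases n with
  | zero =>
    have : a = b := Subsingleton.elim _ _
    subst this
    simp
  | succ n =>
    have hd : ∀ c : Fin (n + 1) →₀ ℕ, c.degree = psum c (Fin.last n) := by
      intro c
      rw [psum, Finsupp.degree_eq_sum]
      congr 1
      ext j
      simp [Fin.le_last]
    have hs : ∀ (c : Fin (n + 1) →₀ ℕ) (k : Fin n),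
        psum c k.succ = psum c k.castSucc + c k.succ := by
      intro c k
      have h : (Finset.Iic k.succ : Finset (Fin (n + 1))) =
          insert k.succ (Finset.Iic k.castSucc) := by
        ext j
        simp only [Finset.mem_Iic, Finset.mem_insert, Fin.le_def, Fin.ext_iff, Fin.val_succ,
          Fin.val_castSucc]
        omega
      rw [psum, h, Finset.sum_insert (by simp [Fin.le_def]), add_comm]
      rfl
    constructor
    · rintro ⟨i, hi, hlt⟩
      rcases Fin.eq_zero_or_eq_succ i with rfl | ⟨k, rfl⟩
      · left
        simpa [hd] using hlt
      · right
        have heq : ∀ j : Fin (n + 1), Fin.rev k.succ < j → psum a j = psum b j := by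
          intro j hj
          have := hi (Fin.rev j) (by rw [← Fin.rev_lt_rev]; simpa using hj)
          simpa using this
        have hk : Fin.rev k.succ = (Fin.rev k).castSucc := Fin.rev_succ k
        rw [hk] at hlt heq
        refine ⟨by rw [hd, hd]; exact heq _ (Fin.castSucc_lt_last _), (Fin.rev k).succ, ?_, ?_⟩
        · have h1 := hs a (Fin.rev k)
          have h2 := hs b (Fin.rev k)
          have h3 := heq (Fin.rev k).succ Fin.castSucc_lt_succ
          omega
        · intro j hj
          rcases Fin.eq_zero_or_eq_succ j with rfl | ⟨l, rfl⟩
          · exact absurd hj (by simp)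
          · have hl : Fin.rev k < l := by simpa using hj
            have h1 := hs a l
            have h2 := hs b l
            have h3 := heq l.succ (by simp [Fin.lt_def] at hl ⊢; omega)
            have h4 := heq l.castSucc (by simpa using hl)
            omega
    · rintro (h | ⟨h, i, hi, hj⟩)
      · exact ⟨0, fun j hj => absurd hj (by simp), by simpa [hd] using h⟩
      · rw [hd, hd] at h
        have heq : ∀ j : Fin (n + 1), i ≤ j → psum a j = psum b j := by
          intro j
          induction j using Fin.reverseInduction with
          | last => intro _; exact h
          | cast k ih =>
            intro hk
            have h1 := hs a k
            have h2 := hs b k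
            have h3 := ih (hk.trans Fin.castSucc_lt_succ.le)
            have h4 := hj k.succ (lt_of_le_of_lt hk Fin.castSucc_lt_succ)
            omega
        rcases Fin.eq_zero_or_eq_succ i with rfl | ⟨k, rfl⟩
        · have h0 := heq 0 le_rfl
          have hz : (Finset.Iic (0 : Fin (n + 1))) = {0} := by
            ext j; simp
          simp only [psum, hz, Finset.sum_singleton] at h0
          omega
        · refine ⟨(Fin.rev k).succ, fun j hj' => heq _ ?_, ?_⟩
          · rw [← Fin.rev_lt_rev, Fin.rev_succ, Fin.rev_rev] at hj'
            rw [Fin.le_def]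
            rw [Fin.lt_def] at hj'
            simp at hj' ⊢
            omega
          · rw [Fin.rev_succ, Fin.rev_rev]
            have h1 := hs a k
            have h2 := hs b k
            have h3 := heq k.succ le_rfl
            omega

lemma grevlexWeight_injective (n : ℕ) : Function.Injective (grevlexWeight n) := by
  intro a b hab
  by_contra hne
  have hex : (Finset.univ.filter fun i => a i ≠ b i).Nonempty := by
    by_contra hemp
    apply hne
    ext i
    by_contra hi
    exact hemp ⟨i, by simpa using hi⟩
  have hi := Finset.max'_mem _ hex
  have hmax : ∀ j, (Finset.univ.filter fun i => a i ≠ b i).max' hex < j → a j = b j := by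
    intro j hj
    by_contra hjne
    exact absurd (Finset.le_max' _ j (by simpa using hjne)) (not_le.mpr hj)
  set i := (Finset.univ.filter fun i => a i ≠ b i).max' hex
  have hi' : a i ≠ b i := by simpa using hi
  have h1 := mt (grevlexWeight_lt_iff a b).mpr (by rw [hab]; exact lt_irrefl _)
  have h2 := mt (grevlexWeight_lt_iff b a).mpr (by rw [hab]; exact lt_irrefl _)
  rcases lt_trichotomy a.degree b.degree with h | h | h
  · exact h1 (Or.inl h)
  · rcases lt_or_gt_of_ne hi' with h' | h'
    · exact h2 (Or.inr ⟨h.symm, i, h', fun j hj => (hmax j hj).symm⟩)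
    · exact h1 (Or.inr ⟨h, i, h', hmax⟩)
  · exact h2 (Or.inl h)

lemma grevlexWeight_nonneg {n : ℕ} (a : Fin n →₀ ℕ) : 0 ≤ grevlexWeight n a := by
  rw [← not_lt]
  intro h
  have h' : grevlexWeight n a < grevlexWeight n 0 := by rwa [map_zero]
  rw [grevlexWeight_lt_iff] at h'
  rcases h' with h' | ⟨hd, i, hi, _⟩
  · simp at h'
  · rw [map_zero, Finsupp.degree_eq_zero_iff] at hd
    simp [hd] at hi

/-- The graded reverse lexicographical order with `x₁ ≻ ⋯ ≻ xₙ`. -/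
noncomputable def grevlex (n : ℕ) : MonomialOrder (Fin n) :=
  pullbackOrder (grevlexWeight n) (grevlexWeight_injective n) grevlexWeight_nonneg

lemma grevlex_lt_iff {n : ℕ} (a b : Fin n →₀ ℕ) :
    (grevlex n).toSyn a < (grevlex n).toSyn b ↔
      a.degree < b.degree ∨
        (a.degree = b.degree ∧ ∃ i, b i < a i ∧ ∀ j, i < j → a j = b j) :=
  grevlexWeight_lt_iff a b

/-- The exponent vector in the variables `x` of a monomial in `(x, y)`. -/
noncomputable def xPart {n t : ℕ} : (Fin n ⊕ Fin t →₀ ℕ) →+ (Fin n →₀ ℕ) :=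
  Finsupp.comapDomain.addMonoidHom Sum.inl_injective

/-- The exponent vector in the parameters `y` of a monomial in `(x, y)`. -/
noncomputable def yPart {n t : ℕ} : (Fin n ⊕ Fin t →₀ ℕ) →+ (Fin t →₀ ℕ) :=
  Finsupp.comapDomain.addMonoidHom Sum.inr_injective

/-- First the grevlex vector of the `x`-part, then that of the `y`-part. -/
noncomputable def elimWeight (n t : ℕ) :
    (Fin n ⊕ Fin t →₀ ℕ) →+ Lex (Lex (Fin n → ℕ) × Lex (Fin t → ℕ)) where
  toFun a := toLex (grevlexWeight n (xPart a), grevlexWeight t (yPart a))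
  map_zero' := by simp only [map_zero]; rfl
  map_add' a b := by simp only [map_add]; rfl

lemma elimWeight_injective (n t : ℕ) : Function.Injective (elimWeight n t) := by
  intro a b hab
  have h : (grevlexWeight n (xPart a), grevlexWeight t (yPart a)) =
      (grevlexWeight n (xPart b), grevlexWeight t (yPart b)) := toLex.injective hab
  have hx := grevlexWeight_injective n (Prod.ext_iff.mp h).1
  have hy := grevlexWeight_injective t (Prod.ext_iff.mp h).2
  ext i
  rcases i with i | i
  · exact DFunLike.congr_fun hx i
  · exact DFunLike.congr_fun hy i

lemma elimWeight_nonneg {n t : ℕ} (a : Fin n ⊕ Fin t →₀ ℕ) : 0 ≤ elimWeight n t a := by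
  rw [← not_lt, ← map_zero (elimWeight n t)]
  intro h
  rcases Prod.Lex.toLex_lt_toLex.mp h with h | ⟨_, h⟩
  · rw [map_zero, map_zero] at h
    exact not_lt.mpr (grevlexWeight_nonneg _) h
  · simp only [map_zero] at h
    exact not_lt.mpr (grevlexWeight_nonneg _) h

/-- The elimination order `grevlex(x) ≻ grevlex(y)` on the monomials in `(x, y)`. -/
noncomputable def elimOrder (n t : ℕ) : MonomialOrder (Fin n ⊕ Fin t) :=
  pullbackOrder (elimWeight n t) (elimWeight_injective n t) elimWeight_nonneg

lemma elimOrder_lt_iff {n t : ℕ} (a b : Fin n ⊕ Fin t →₀ ℕ) :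
    (elimOrder n t).toSyn a < (elimOrder n t).toSyn b ↔
      (grevlex n).toSyn (xPart a) < (grevlex n).toSyn (xPart b) ∨
        (xPart a = xPart b ∧ (grevlex t).toSyn (yPart a) < (grevlex t).toSyn (yPart b)) := by
  have h : (elimOrder n t).toSyn a < (elimOrder n t).toSyn b ↔
      grevlexWeight n (xPart a) < grevlexWeight n (xPart b) ∨
        (grevlexWeight n (xPart a) = grevlexWeight n (xPart b) ∧
          grevlexWeight t (yPart a) < grevlexWeight t (yPart b)) := Prod.Lex.toLex_lt_toLex
  rw [h, (grevlexWeight_injective n).eq_iff]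
  rfl

/-! ### Gröbner bases -/

/-- The ideal generated by the leading monomials of the nonzero elements of `S`. -/
noncomputable def leadingIdeal {σ k : Type} [Field k] (ord : MonomialOrder σ)
    (S : Set (MvPolynomial σ k)) : Ideal (MvPolynomial σ k) :=
  Ideal.span ((fun p => monomial (ord.degree p) (1 : k)) '' (S \ {0}))

/-- `G` is a Gröbner basis of `I`: it generates `I`, and its leading monomials generate the
initial ideal of `I`. -/
def IsGroebnerBasis {σ k : Type} [Field k] (ord : MonomialOrder σ)
    (G : Finset (MvPolynomial σ k)) (I : Ideal (MvPolynomial σ k)) : Prop :=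
  Ideal.span (G : Set (MvPolynomial σ k)) = I ∧
    leadingIdeal ord (G : Set (MvPolynomial σ k)) = leadingIdeal ord (I : Set (MvPolynomial σ k))

/-- `G` is the reduced Gröbner basis of `I`: its elements are monic, and no monomial of an element
is divisible by the leading monomial of another element. -/
def IsReducedGroebnerBasis {σ k : Type} [Field k] (ord : MonomialOrder σ)
    (G : Finset (MvPolynomial σ k)) (I : Ideal (MvPolynomial σ k)) : Prop :=
  IsGroebnerBasis ord G I ∧ (∀ g ∈ G, ord.Monic g) ∧
    ∀ g ∈ G, ∀ h ∈ G, h ≠ g → ∀ a ∈ g.support, ¬ ord.degree h ≤ a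

/-! ### Parametric systems -/

/-- `ℚ[x, y]`, with variables `x` (`Sum.inl`) and parameters `y` (`Sum.inr`). -/
abbrev Poly (n t : ℕ) : Type := MvPolynomial (Fin n ⊕ Fin t) ℚ

/-- The ring `ℚ[y]` of polynomials in the parameters. -/
abbrev ParamPoly (t : ℕ) : Type := MvPolynomial (Fin t) ℚ

/-- The field `𝕂 = ℚ(y)`. -/
abbrev ParamField (t : ℕ) : Type := FractionRing (ParamPoly t)

/-- There is a nonempty Zariski open subset of `ℂᵗ` over which the complex fibres of the system
`f = 0` are nonempty and finite. -/
def AssumptionA {t n m : ℕ} (f : Fin m → Poly n t) : Prop :=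
  ∃ J : Ideal (MvPolynomial (Fin t) ℂ), (zeroLocus ℂ J)ᶜ.Nonempty ∧
    ∀ η ∈ (zeroLocus ℂ J)ᶜ,
      {x : Fin n → ℂ | ∀ i, aeval (Sum.elim x η) (f i) = 0}.Nonempty ∧
      {x : Fin n → ℂ | ∀ i, aeval (Sum.elim x η) (f i) = 0}.Finite

/-- The real roots of `f(η, ·)`. -/
def realFiber {t n m : ℕ} (f : Fin m → Poly n t) (η : Fin t → ℝ) : Set (Fin n → ℝ) :=
  {x | ∀ i, aeval (Sum.elim x η) (f i) = 0}

/-- `lm_x(g)`, for `g` regarded as an element of `ℚ[y][x]`. -/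
noncomputable def lmX {n t : ℕ} (g : Poly n t) : Fin n →₀ ℕ :=
  (grevlex n).degree (sumAlgEquiv ℚ (Fin n) (Fin t) g)

/-- `lc_x(g) ∈ ℚ[y]`, for `g` regarded as an element of `ℚ[y][x]`. -/
noncomputable def lcX {n t : ℕ} (g : Poly n t) : ParamPoly t :=
  (grevlex n).leadingCoeff (sumAlgEquiv ℚ (Fin n) (Fin t) g)

/-- The real points of `𝒲_∞ = ⋃_{g ∈ G} V(lc_x(g))`. -/
def Winf {n t : ℕ} (G : Finset (Poly n t)) : Set (Fin t → ℝ) :=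
  {η | ∃ g ∈ G, aeval η (lcX g) = 0}

/-- `w_∞`: the square-free part of `lcm_{g ∈ G} lc_x(g)`. -/
noncomputable def winf {n t : ℕ} (G : Finset (Poly n t)) : ParamPoly t :=
  letI : NormalizedGCDMonoid (ParamPoly t) := Nonempty.some inferInstance
  UniqueFactorizationMonoid.radical (G.lcm lcX)

/-- The set `ℬ` of monomials in `x` that are not reducible by `G`. -/
def standardMonomials {n t : ℕ} (G : Finset (Poly n t)) : Set (Fin n →₀ ℕ) :=
  {a | ∀ g ∈ G, ¬ lmX g ≤ a}

/-- The ideal `⟨f⟩_𝕂` of `𝕂[x]`. -/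
noncomputable def idealK {t n m : ℕ} (f : Fin m → Poly n t) :
    Ideal (MvPolynomial (Fin n) (ParamField t)) :=
  Ideal.span (Set.range fun i =>
    map (algebraMap (ParamPoly t) (ParamField t)) (sumAlgEquiv ℚ (Fin n) (Fin t) (f i)))

/-- The parametric Hermite matrix `(trace(𝓛_{bᵢ bⱼ}))` of `f` with respect to the monomials
`b₁, …, b_δ`, where `𝓛_p` is multiplication by `p` on `𝕂[x]/⟨f⟩_𝕂`. -/
noncomputable def hermite {t n m δ : ℕ} (f : Fin m → Poly n t) (b : Fin δ → (Fin n →₀ ℕ)) :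
    Matrix (Fin δ) (Fin δ) (ParamField t) :=
  Matrix.of fun i j =>
    Algebra.trace (ParamField t) (MvPolynomial (Fin n) (ParamField t) ⧸ idealK f)
      (Ideal.Quotient.mk (idealK f) (monomial (b i) 1 * monomial (b j) 1))

/-- The leading principal minor formed by the rows and columns of index at most `i`. -/
def leadingMinor {R : Type} [CommRing R] {δ : ℕ} (S : Matrix (Fin δ) (Fin δ) R) (i : Fin δ) : R :=
  (S.submatrix (Fin.castLE i.isLt) (Fin.castLE i.isLt)).det

/-- The leading principal minors of `H_A = Aᵀ H A`. -/
noncomputable def minors {t δ : ℕ} (H : Matrix (Fin δ) (Fin δ) (ParamField t))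
    (A : GL (Fin δ) ℚ) : Fin δ → ParamField t :=
  leadingMinor
    (((A : Matrix (Fin δ) (Fin δ) ℚ).map (algebraMap ℚ (ParamField t))).transpose * H *
      (A : Matrix (Fin δ) (Fin δ) ℚ).map (algebraMap ℚ (ParamField t)))

/-- A set of invertible rational matrices is Zariski dense in `GL_δ(ℚ)`: every polynomial in the
entries that vanishes on the set vanishes on `GL_δ(ℚ)`. -/
def ZariskiDenseGL {δ : ℕ} (𝒜 : Set (GL (Fin δ) ℚ)) : Prop :=
  ∀ P : MvPolynomial (Fin δ × Fin δ) ℚ,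
    (∀ A ∈ 𝒜, eval (fun p => (A : Matrix (Fin δ) (Fin δ) ℚ) p.1 p.2) P = 0) →
      ∀ A : GL (Fin δ) ℚ, eval (fun p => (A : Matrix (Fin δ) (Fin δ) ℚ) p.1 p.2) P = 0

/-! ### Specialization of rational functions -/

/-- The denominator of the reduced fraction `r` does not vanish at `η`. -/
def DefinedAt {t : ℕ} (r : ParamField t) (η : Fin t → ℝ) : Prop :=
  aeval η (IsFractionRing.den (ParamPoly t) r : ParamPoly t) ≠ 0

/-- The value at `η` of the rational function `r` (meaningful where `r` is defined). -/
noncomputable def evalAt {t : ℕ} (r : ParamField t) (η : Fin t → ℝ) : ℝ :=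
  aeval η (IsFractionRing.num (ParamPoly t) r) /
    aeval η (IsFractionRing.den (ParamPoly t) r : ParamPoly t)

/-- The semi-algebraic set on which all `Mᵢ` are defined and nonzero. -/
def nonvanishing {t δ : ℕ} (M : Fin δ → ParamField t) : Set (Fin t → ℝ) :=
  {η | ∀ i, DefinedAt (M i) η ∧ evalAt (M i) η ≠ 0}

/-- The signature of a real symmetric matrix. -/
noncomputable def signature {δ : ℕ} (S : Matrix (Fin δ) (Fin δ) ℝ) : ℤ :=
  (sigPos S.toQuadraticForm' : ℤ) - (sigNeg S.toQuadraticForm' : ℤ)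

/-! ### Real root classification -/

/-- A finite disjunction of finite conjunctions of conditions `sign p = s`, where `p ∈ ℚ[y]` and
`s ∈ {-1, 0, 1}`. -/
abbrev SAFormula (t : ℕ) : Type := List (List (ParamPoly t × SignType))

/-- The semi-algebraic subset of `ℝᵗ` that a formula defines. -/
def SAFormula.toSet {t : ℕ} (Φ : SAFormula t) : Set (Fin t → ℝ) :=
  {η | ∃ c ∈ Φ, ∀ q ∈ c, SignType.sign (aeval η q.1 : ℝ) = q.2}

/-- The real point with the given rational coordinates. -/
def toReal {t : ℕ} (η : Fin t → ℚ) : Fin t → ℝ := fun i => (η i : ℝ)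

/-- The set `out` of triples (formula, sample point, number of real roots) solves the real root
classification problem for `f`. -/
def SolvesRRC {t n m : ℕ} (f : Fin m → Poly n t)
    (out : Set (SAFormula t × (Fin t → ℚ) × ℤ)) : Prop :=
  out.Finite ∧
  (∀ o ∈ out,
    (∀ η ∈ o.1.toSet, ∀ η' ∈ o.1.toSet, (realFiber f η).encard = (realFiber f η').encard) ∧
    toReal o.2.1 ∈ o.1.toSet ∧
    (realFiber f (toReal o.2.1)).Finite ∧
    ((realFiber f (toReal o.2.1)).ncard : ℤ) = o.2.2) ∧
  Dense (⋃ o ∈ out, o.1.toSet)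

/-- Specification of the subroutine `SamplePoints`: `L` is a finite set of rational points of `U`
that meets every connected component of `U`. -/
def IsSamplePoints {t : ℕ} (U : Set (Fin t → ℝ)) (L : Finset (Fin t → ℚ)) : Prop :=
  (∀ η ∈ L, toReal η ∈ U) ∧ ∀ p ∈ U, ∃ η ∈ L, toReal η ∈ connectedComponentIn U p

/-- The formula
`w ≠ 0 ∧ sign M₁ = sign M₁(η) ∧ ⋯ ∧ sign M_δ = sign M_δ(η)`.
Here `w ≠ 0` is written `w² > 0`, and the sign of a fraction is that of the product of its
numerator and its denominator. -/
noncomputable def signFormula {t δ : ℕ} (w : ParamPoly t) (M : Fin δ → ParamField t)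
    (η : Fin t → ℝ) : SAFormula t :=
  [(w ^ 2, 1) :: List.ofFn fun i =>
    (IsFractionRing.num (ParamPoly t) (M i) *
        (IsFractionRing.den (ParamPoly t) (M i) : ParamPoly t),
      SignType.sign (evalAt (M i) η))]

/-- `out` is a possible output of the algorithm RRC-Hermite on input `f`, when its subroutine
DRL-Matrix uses the Gröbner basis `G` and the enumeration `b` of the monomial basis, and the matrix
chosen is `A`. The steps are: compute `H` and `w_∞`; compute the leading principal minors `M` of
`Aᵀ H A`; compute sample points `L` of the set `w_∞ ≠ 0 ∧ M₁ ≠ 0 ∧ ⋯ ∧ M_δ ≠ 0`; return, for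
each `η ∈ L`, the sign condition on `M` realized at `η`, the point `η`, and the signature of
`H(η)`. -/
def IsRRCHermiteOutput {t n m δ : ℕ} (f : Fin m → Poly n t) (G : Finset (Poly n t))
    (b : Fin δ → (Fin n →₀ ℕ)) (A : GL (Fin δ) ℚ)
    (out : Set (SAFormula t × (Fin t → ℚ) × ℤ)) : Prop :=
  let H := hermite f b
  let w := winf G
  let M := minors H A
  ∃ L : Finset (Fin t → ℚ),
    IsSamplePoints {η | (aeval η w : ℝ) ≠ 0 ∧ η ∈ nonvanishing M} L ∧
    out = (fun η => (signFormula w M (toReal η), η,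
      signature (H.map fun r => evalAt r (toReal η)))) '' (L : Set (Fin t → ℚ))

end RRC

namespace RRC

open MvPolynomial

/-! ### Normal forms with respect to polynomials with invertible leading coefficients -/

section NormalForm

variable {σ : Type*} {R : Type*} [CommRing R]

/-! The whole argument takes place over `CoeffRing G`, the ring `ℚ[y]` with all the `lc_x(g)`
inverted. Division by `G` shows that the standard monomials span the quotient algebra there, and the
elimination property of `G` makes them independent (`exists_basis_coeffRing`). The algebra is thus
free, and its basis, multiplication tables and traces specialize along every ring map that inverts
the `lc_x(g)` (`exists_basis_systemIdeal`, `trace_specialize`). The generic fibre over `𝕂` and the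
real and complex fibres outside `𝒲_∞` are all instances. A finite complex fibre outside `𝒲_∞` has a
finite-dimensional algebra by the Nullstellensatz, so `ℬ` is finite.

Density: the generic algebra is reduced because `⟨f⟩` is radical, so in characteristic zero its
trace form is nondegenerate. A matrix over `𝕂` diagonalizing the form has only nonzero minors, so
each minor is a nonzero polynomial in the entries of `A`; the rational points, being Zariski dense,
then supply enough good `A` (`zariskiDenseGL_leadingMinor`).

Counting: at a real `η` outside `𝒲_∞` where the minors do not vanish, the Hermite matrix is
nonsingular, which forces the fibre algebra to be reduced. By Hermite's theorem
(`signature_trace_eq_card`) the signature of the matrix is the number of real zeros, and by Jacobi's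
diagonalization that signature depends only on the signs of the leading minors
(`signature_eq_of_sign_leadingMinor_eq`). These signs are constant on connected sets where the
minors are defined and nonzero.

Sampling: the set to be sampled is the complement of a real hypersurface. It has finitely many
components by induction on the dimension (`finitelyManyComponents_ne_zero`), and each, being open,
contains a rational point. The sampled sign conditions cover this complement, which is dense because
its defining polynomial is nonzero. -/

lemma degree_map_of_leadingCoeff_ne_zero (m : MonomialOrder σ) {k : Type*} [CommRing k]
    (φ : R →+* k) {g : MvPolynomial σ R} (h : φ (m.leadingCoeff g) ≠ 0) :
    m.degree (map φ g) = m.degree g := by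
  apply m.toSyn.injective
  apply le_antisymm
  · rw [m.degree_le_iff]
    intro c hc
    exact m.le_degree (support_map_subset _ _ hc)
  · apply m.le_degree
    rw [mem_support_iff, coeff_map]
    exact h

lemma leadingCoeff_map_of_ne_zero (m : MonomialOrder σ) {k : Type*} [CommRing k]
    (φ : R →+* k) {g : MvPolynomial σ R} (h : φ (m.leadingCoeff g) ≠ 0) :
    m.leadingCoeff (map φ g) = φ (m.leadingCoeff g) := by
  rw [MonomialOrder.leadingCoeff, degree_map_of_leadingCoeff_ne_zero m φ h, coeff_map]
  rfl

/-- Every polynomial is congruent to a combination of standard monomials once the leading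
coefficients have become invertible. -/
lemma exists_normalForm (m : MonomialOrder σ) {k : Type*} [CommRing k] [Nontrivial k]
    (φ : R →+* k) {ι : Type*} (g : ι → MvPolynomial σ R) (I : Ideal (MvPolynomial σ R))
    (hgI : ∀ i, g i ∈ I) (hu : ∀ i, IsUnit (φ (m.leadingCoeff (g i))))
    (B : Set (σ →₀ ℕ)) (hB : ∀ a, a ∈ B ↔ ∀ i, ¬ m.degree (g i) ≤ a) (p : MvPolynomial σ k) :
    ∃ r : MvPolynomial σ k, (∀ a ∈ r.support, a ∈ B) ∧ p - r ∈ I.map (map φ) := by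
  have hlc := fun i => leadingCoeff_map_of_ne_zero m φ (hu i).ne_zero
  have hdeg := fun i => degree_map_of_leadingCoeff_ne_zero m φ (hu i).ne_zero
  obtain ⟨c, r, hp, -, hr⟩ := m.div (b := fun i => map φ (g i))
    (fun i => by rw [hlc]; exact hu i) p
  refine ⟨r, fun a ha => (hB a).2 fun i => ?_, ?_⟩
  · rw [← hdeg i]
    exact hr a ha i
  · rw [hp, add_sub_cancel_right, Finsupp.linearCombination_apply]
    exact Ideal.sum_mem _ fun i _ =>
      Ideal.mul_mem_left _ _ (Ideal.mem_map_of_mem _ (hgI i))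

/-- A combination of standard monomials that lies in the localized ideal is zero. -/
lemma eq_zero_of_mem_map_of_support_subset [IsDomain R] (m : MonomialOrder σ) (M : Submonoid R)
    (hM : M ≤ nonZeroDivisors R)
    {S : Type*} [CommRing S] [Algebra R S] [IsLocalization M S] {ι : Type*}
    (g : ι → MvPolynomial σ R) (I : Ideal (MvPolynomial σ R))
    (hlead : ∀ p ∈ I, p ≠ 0 → ∃ i, m.degree (g i) ≤ m.degree p)
    (B : Set (σ →₀ ℕ)) (hB : ∀ a, a ∈ B ↔ ∀ i, ¬ m.degree (g i) ≤ a) {r : MvPolynomial σ S}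
    (hr : ∀ a ∈ r.support, a ∈ B) (hrI : r ∈ I.map (map (algebraMap R S))) : r = 0 := by
  let : Algebra (MvPolynomial σ R) (MvPolynomial σ S) := algebraMvPolynomial
  have hloc := MvPolynomial.isLocalization (σ := σ) M S
  have hinj : Function.Injective (algebraMap R S) := IsLocalization.injective S hM
  obtain ⟨⟨⟨p, hp⟩, ⟨_, s, hs, rfl⟩⟩, h⟩ :=
    (IsLocalization.mem_map_algebraMap_iff (M.map (C : R →+* MvPolynomial σ R))
      (MvPolynomial σ S)).1 hrI
  simp only [algebraMap_def, map_C] at h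
  have hsu : IsUnit (algebraMap R S s) := IsLocalization.map_units S ⟨s, hs⟩
  -- After clearing denominators, `r` times a unit constant is the image of `p ∈ I`. The leading
  -- monomial of a nonzero `p` would survive in `r`, yet it is divisible by some leading monomial of
  -- `g`.
  have hp0 : p = 0 := by
    by_contra hne
    obtain ⟨i, hi⟩ := hlead p hp hne
    refine (hB (m.degree p)).1 (hr _ ?_) i hi
    have hc : coeff (m.degree p) (map (algebraMap R S) p) ≠ 0 := by
      rw [coeff_map]
      exact fun h0 => mem_support_iff.1 (m.degree_mem_support hne)
        (hinj (by rw [h0, map_zero]))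
    rw [← h, mul_comm, coeff_C_mul] at hc
    rw [mem_support_iff]
    exact right_ne_zero_of_mul hc
  rw [hp0, map_zero] at h
  have hCu : IsUnit (C (algebraMap R S s) : MvPolynomial σ S) := hsu.map C
  exact hCu.mul_left_eq_zero.1 h

/-- The standard monomials, as elements of a quotient ring. -/
noncomputable def monomialFamily {k : Type*} [CommRing k] (B : Set (σ →₀ ℕ))
    (J : Ideal (MvPolynomial σ k)) : B → MvPolynomial σ k ⧸ J :=
  fun b => Ideal.Quotient.mk J (monomial (b : σ →₀ ℕ) 1)

lemma linearCombination_monomialFamily {k : Type*} [CommRing k] (B : Set (σ →₀ ℕ))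
    (J : Ideal (MvPolynomial σ k)) (c : B →₀ k) :
    Finsupp.linearCombination k (monomialFamily B J) c =
      Ideal.Quotient.mk J (c.sum fun b x => monomial (b : σ →₀ ℕ) x) := by
  rw [Finsupp.linearCombination_apply, map_finsuppSum]
  refine Finsupp.sum_congr fun b _ => ?_
  rw [monomialFamily, ← Ideal.Quotient.mkₐ_eq_mk k, ← map_smul, smul_monomial, smul_eq_mul, mul_one]

lemma coeff_sum_monomial {k : Type*} [CommRing k] (B : Set (σ →₀ ℕ)) (c : B →₀ k) (b : B) :
    coeff (b : σ →₀ ℕ) (c.sum fun b x => monomial (b : σ →₀ ℕ) x) = c b := by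
  classical
  rw [Finsupp.sum, coeff_sum]
  simp only [coeff_monomial]
  rw [Finset.sum_eq_single b]
  · simp
  · intro b' _ hne
    rw [if_neg fun h => hne (Subtype.ext h)]
  · intro h
    simpa using h

lemma linearIndependent_monomialFamily {k : Type*} [CommRing k] (B : Set (σ →₀ ℕ))
    (J : Ideal (MvPolynomial σ k))
    (h : ∀ r : MvPolynomial σ k, (∀ a ∈ r.support, a ∈ B) → r ∈ J → r = 0) :
    LinearIndependent k (monomialFamily B J) := by
  rw [linearIndependent_iff]
  intro c hc
  rw [linearCombination_monomialFamily, Ideal.Quotient.eq_zero_iff_mem] at hc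
  have h0 := h _ (fun a ha => ?_) hc
  · ext b
    rw [← coeff_sum_monomial B c b, h0]
    simp
  · rw [Finsupp.sum] at ha
    classical
    obtain ⟨b, -, hb⟩ := Finset.mem_biUnion.1 (support_sum ha)
    have := support_monomial_subset hb
    rw [Finset.mem_singleton] at this
    rw [this]
    exact b.2

lemma span_monomialFamily {k : Type*} [CommRing k] (B : Set (σ →₀ ℕ))
    (J : Ideal (MvPolynomial σ k))
    (h : ∀ p : MvPolynomial σ k, ∃ r : MvPolynomial σ k, (∀ a ∈ r.support, a ∈ B) ∧ p - r ∈ J) :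
    ⊤ ≤ Submodule.span k (Set.range (monomialFamily B J)) := by
  intro x _
  obtain ⟨p, rfl⟩ := Ideal.Quotient.mk_surjective x
  obtain ⟨r, hr, hpr⟩ := h p
  rw [Ideal.Quotient.eq.2 hpr, r.as_sum, map_sum]
  refine Submodule.sum_mem _ fun a ha => ?_
  have : Ideal.Quotient.mk J (monomial a (coeff a r)) =
      coeff a r • monomialFamily B J ⟨a, hr a ha⟩ := by
    rw [monomialFamily, ← Ideal.Quotient.mkₐ_eq_mk k, ← map_smul, smul_monomial, smul_eq_mul,
      mul_one]
  rw [this]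
  exact Submodule.smul_mem _ _ (Submodule.subset_span ⟨_, rfl⟩)

end NormalForm

/-! ### Specialization of quotient algebras that are free on monomials -/

section Specialize

variable {σ : Type*} {S : Type*} [CommRing S] {k : Type*} [CommRing k]

/-- The specialization of the coordinates on a quotient algebra with a basis. -/
noncomputable def specializeCoord (φ : S →+* k) {B : Type*} {J : Ideal (MvPolynomial σ S)}
    (β : Module.Basis B S (MvPolynomial σ S ⧸ J)) : MvPolynomial σ k →ₗ[k] (B →₀ k) :=
  (basisMonomials σ k).constr k fun a =>
    (β.repr (Ideal.Quotient.mk J (monomial a 1))).mapRange φ (map_zero φ)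

lemma specializeCoord_map (φ : S →+* k) {B : Type*} {J : Ideal (MvPolynomial σ S)}
    (β : Module.Basis B S (MvPolynomial σ S ⧸ J)) (p : MvPolynomial σ S) (b : B) :
    specializeCoord φ β (map φ p) b = φ (β.repr (Ideal.Quotient.mk J p) b) := by
  induction p using MvPolynomial.induction_on' with
  | monomial a c =>
    have h1 : (monomial a (φ c) : MvPolynomial σ k) = φ c • basisMonomials σ k a := by
      rw [coe_basisMonomials, smul_monomial, smul_eq_mul, mul_one]
    have h2 : (monomial a c : MvPolynomial σ S) = c • monomial a 1 := by
      rw [smul_monomial, smul_eq_mul, mul_one]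
    rw [map_monomial, h1, map_smul, specializeCoord, Module.Basis.constr_basis, h2,
      ← Ideal.Quotient.mkₐ_eq_mk S, map_smul, map_smul]
    simp
  | add p q hp hq => simp [hp, hq]

/-- A monomial multiple of the image of `q ∈ J` is a scalar times the image of another element of
`J`, whose coordinates vanish already over `S`. This lets the specialized coordinates descend to the
quotient. -/
lemma specializeCoord_eq_zero (φ : S →+* k) {B : Type*} {J : Ideal (MvPolynomial σ S)}
    (β : Module.Basis B S (MvPolynomial σ S ⧸ J)) {p : MvPolynomial σ k}
    (hp : p ∈ J.map (map φ)) : specializeCoord φ β p = 0 := by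
  -- The coordinate map is only `k`-linear while the ideal is a span over the polynomial ring, so
  -- the induction has to carry an arbitrary multiplier.
  suffices h : ∀ h : MvPolynomial σ k, specializeCoord φ β (h * p) = 0 by simpa using h 1
  refine Submodule.span_induction (p := fun p _ => ∀ h, specializeCoord φ β (h * p) = 0) ?_
    (fun h => by rw [mul_zero, map_zero])
    (fun p q _ _ hp hq h => by rw [mul_add, map_add, hp, hq, add_zero])
    (fun a p _ hp h => by rw [smul_eq_mul, ← mul_assoc, hp])
    (show p ∈ Submodule.span (MvPolynomial σ k) (map φ '' (J : Set (MvPolynomial σ S))) from hp)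
  rintro _ ⟨q, hq, rfl⟩ h
  induction h using MvPolynomial.induction_on' with
  | monomial a c =>
    have h1 : (monomial a c : MvPolynomial σ k) * map φ q = c • map φ (monomial a 1 * q) := by
      rw [map_mul, map_monomial, map_one, ← smul_mul_assoc, smul_monomial, smul_eq_mul, mul_one]
    rw [h1, map_smul]
    ext b
    rw [Finsupp.smul_apply, specializeCoord_map,
      Ideal.Quotient.eq_zero_iff_mem.2 (J.mul_mem_left _ hq)]
    simp
  | add p q hp hq => rw [add_mul, map_add, hp, hq, add_zero]

/-- The specialization of a quotient algebra that is free on a set of monomials, provided that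
these monomials still span, is free on the same monomials, with the specialized coordinates. -/
lemma exists_basis_specialize (φ : S →+* k) {B : Set (σ →₀ ℕ)} {J : Ideal (MvPolynomial σ S)}
    (β : Module.Basis B S (MvPolynomial σ S ⧸ J)) (hβ : ∀ b, β b = monomialFamily B J b)
    (hspan : ∀ p : MvPolynomial σ k,
      ∃ r : MvPolynomial σ k, (∀ a ∈ r.support, a ∈ B) ∧ p - r ∈ J.map (map φ))
    {J' : Ideal (MvPolynomial σ k)} (hJ' : J' = J.map (map φ)) :
    ∃ γ : Module.Basis B k (MvPolynomial σ k ⧸ J'),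
      (∀ b, γ b = monomialFamily B _ b) ∧
      ∀ p b, γ.repr (Ideal.Quotient.mk _ (map φ p)) b = φ (β.repr (Ideal.Quotient.mk J p) b) := by
  subst hJ'
  let Λ : (MvPolynomial σ k ⧸ J.map (map φ)) →ₗ[k] (B →₀ k) :=
    ((J.map (map φ)).restrictScalars k).liftQ (specializeCoord φ β)
      fun p hp => specializeCoord_eq_zero φ β hp
  have hΛ : ∀ p, Λ (Ideal.Quotient.mk _ p) = specializeCoord φ β p := fun p => rfl
  have hΛb : ∀ b, Λ (monomialFamily B _ b) = Finsupp.single b 1 := by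
    intro b
    have hb : (monomial (b : σ →₀ ℕ) (1 : k)) = map φ (monomial (b : σ →₀ ℕ) 1) := by
      rw [map_monomial, φ.map_one]
    ext b'
    rw [monomialFamily, hΛ, hb, specializeCoord_map]
    have := hβ b
    rw [monomialFamily] at this
    rw [← this, β.repr_self]
    classical
    simp [Finsupp.single_apply, apply_ite φ]
  -- Independence survives specialization because `Λ` sends the monomials to the standard basis.
  have hli : LinearIndependent k (monomialFamily B (J.map (map φ))) := by
    refine LinearIndependent.of_comp Λ ?_
    have : (Λ ∘ monomialFamily B (J.map (map φ))) = Finsupp.basisSingleOne (R := k) := by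
      funext b
      rw [Function.comp_apply, hΛb, Finsupp.coe_basisSingleOne]
    rw [this]
    exact Finsupp.basisSingleOne.linearIndependent
  let γ := Module.Basis.mk hli (span_monomialFamily B _ hspan)
  have hγ : ∀ b, γ b = monomialFamily B _ b := fun b => Module.Basis.mk_apply _ _ b
  have hrepr : γ.repr.toLinearMap = Λ := by
    refine γ.ext fun b => ?_
    rw [LinearEquiv.coe_coe, γ.repr_self, hγ, hΛb]
  refine ⟨γ, hγ, fun p b => ?_⟩
  rw [← specializeCoord_map, ← hΛ, ← hrepr]
  rfl

/-- The trace commutes with specialization. -/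
lemma trace_specialize (φ : S →+* k) {B : Set (σ →₀ ℕ)} [Finite B] {J : Ideal (MvPolynomial σ S)}
    (β : Module.Basis B S (MvPolynomial σ S ⧸ J)) (hβ : ∀ b, β b = monomialFamily B J b)
    {J' : Ideal (MvPolynomial σ k)} (γ : Module.Basis B k (MvPolynomial σ k ⧸ J'))
    (hγ : ∀ b, γ b = monomialFamily B _ b)
    (h : ∀ p b, γ.repr (Ideal.Quotient.mk _ (map φ p)) b = φ (β.repr (Ideal.Quotient.mk J p) b))
    (p : MvPolynomial σ S) :
    Algebra.trace k (MvPolynomial σ k ⧸ J') (Ideal.Quotient.mk _ (map φ p)) =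
      φ (Algebra.trace S (MvPolynomial σ S ⧸ J) (Ideal.Quotient.mk _ p)) := by
  classical
  have := Fintype.ofFinite B
  rw [Algebra.trace_eq_matrix_trace γ, Algebra.trace_eq_matrix_trace β, Matrix.trace, Matrix.trace,
    map_sum]
  refine Finset.sum_congr rfl fun b _ => ?_
  rw [Matrix.diag_apply, Matrix.diag_apply, Algebra.leftMulMatrix_eq_repr_mul,
    Algebra.leftMulMatrix_eq_repr_mul, hγ, hβ, monomialFamily, monomialFamily, ← map_mul,
    ← map_mul, ← h, (map φ).map_mul,
    map_monomial, φ.map_one]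

end Specialize

end RRC

namespace RRC

open MvPolynomial

/-! ### The elimination order -/

section Elimination

variable {n t : ℕ}

lemma sumAlgEquiv_monomial (d : Fin n ⊕ Fin t →₀ ℕ) (c : ℚ) :
    sumAlgEquiv ℚ (Fin n) (Fin t) (monomial d c) = monomial (xPart d) (monomial (yPart d) c) := by
  simp [sumAlgEquiv, monomial]
  rfl

lemma exists_xPart_yPart (a : Fin n →₀ ℕ) (c : Fin t →₀ ℕ) :
    ∃ d : Fin n ⊕ Fin t →₀ ℕ, xPart d = a ∧ yPart d = c :=
  ⟨Finsupp.sumElim a c, by ext; simp [xPart], by ext; simp [yPart]⟩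

lemma xPart_yPart_inj {d e : Fin n ⊕ Fin t →₀ ℕ} (hx : xPart d = xPart e) (hy : yPart d = yPart e) :
    d = e := by
  ext (i | i)
  · exact DFunLike.congr_fun hx i
  · exact DFunLike.congr_fun hy i

lemma coeff_sumAlgEquiv (p : Poly n t) (d : Fin n ⊕ Fin t →₀ ℕ) :
    coeff (yPart d) (coeff (xPart d) (sumAlgEquiv ℚ (Fin n) (Fin t) p)) = coeff d p := by
  classical
  induction p using MvPolynomial.induction_on' with
  | monomial e c =>
    rw [sumAlgEquiv_monomial, coeff_monomial]
    split_ifs with h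
    · rw [coeff_monomial, coeff_monomial]
      congr 1
      exact propext ⟨fun h' => xPart_yPart_inj h h', fun h' => by rw [h']⟩
    · rw [coeff_zero, coeff_monomial, if_neg fun h' => h (by rw [h'])]
  | add p q hp hq => simp [hp, hq]
-- The elimination order compares `x`-parts first, so grouping the terms of `p` by `x`-monomial does
-- not change which `x`-part is largest.
lemma xPart_degree_elimOrder {p : Poly n t} (hp : p ≠ 0) :
    xPart ((elimOrder n t).degree p) = lmX p := by
  have hp' : sumAlgEquiv ℚ (Fin n) (Fin t) p ≠ 0 := by simpa using hp
  apply (grevlex n).toSyn.injective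
  apply le_antisymm
  · apply (grevlex n).le_degree
    rw [mem_support_iff]
    intro h
    have := (elimOrder n t).degree_mem_support hp
    rw [mem_support_iff, ← coeff_sumAlgEquiv, h] at this
    simp at this
  · have h := (grevlex n).degree_mem_support hp'
    rw [mem_support_iff, ne_zero_iff] at h
    obtain ⟨c, hc⟩ := h
    obtain ⟨d, hd, rfl⟩ := exists_xPart_yPart (lmX p) c
    rw [← lmX, ← hd, coeff_sumAlgEquiv] at hc
    have hle := (elimOrder n t).le_degree (mem_support_iff.2 hc)
    rw [← hd]
    by_contra hlt
    exact absurd ((elimOrder_lt_iff _ _).2 (Or.inl (not_le.1 hlt))) (not_lt.2 hle)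

/-- The `x`-leading monomials of a Gröbner basis for the elimination order generate the
`x`-leading monomials of the ideal. -/
lemma exists_lmX_le {I : Ideal (Poly n t)} {G : Finset (Poly n t)}
    (hG : IsGroebnerBasis (elimOrder n t) G I) {p : Poly n t} (hpI : p ∈ I) (hp : p ≠ 0) :
    ∃ g ∈ G, lmX g ≤ lmX p := by
  have h : monomial ((elimOrder n t).degree p) (1 : ℚ) ∈
      leadingIdeal (elimOrder n t) (G : Set (Poly n t)) := by
    rw [hG.2]
    exact Ideal.subset_span ⟨p, ⟨hpI, hp⟩, rfl⟩
  rw [leadingIdeal, ← Set.image_image (fun s => monomial s (1 : ℚ)),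
    mem_ideal_span_monomial_image] at h
  obtain ⟨_, ⟨g, ⟨hgG, hg⟩, rfl⟩, hle⟩ := h ((elimOrder n t).degree p) (by simp)
  refine ⟨g, hgG, ?_⟩
  rw [← xPart_degree_elimOrder hg, ← xPart_degree_elimOrder hp]
  exact fun i => hle (Sum.inl i)

lemma IsReducedGroebnerBasis.ne_zero {I : Ideal (Poly n t)} {G : Finset (Poly n t)}
    (hG : IsReducedGroebnerBasis (elimOrder n t) G I) {g : Poly n t} (hg : g ∈ G) : g ≠ 0 := by
  rintro rfl
  have := hG.2.1 0 hg
  simp [MonomialOrder.Monic] at this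

end Elimination

/-! ### Specializations of a parametric system -/

section System

variable {t n m : ℕ}

/-- The ideal generated by the specialization of the system along `φ`. -/
noncomputable def systemIdeal {k : Type*} [CommRing k] (f : Fin m → Poly n t)
    (φ : ParamPoly t →+* k) : Ideal (MvPolynomial (Fin n) k) :=
  Ideal.span (Set.range fun i => map φ (sumAlgEquiv ℚ (Fin n) (Fin t) (f i)))

lemma systemIdeal_eq_map {k : Type*} [CommRing k] (f : Fin m → Poly n t) (φ : ParamPoly t →+* k) :
    systemIdeal f φ = ((Ideal.span (Set.range f)).map
      (sumAlgEquiv ℚ (Fin n) (Fin t) : Poly n t →+* _)).map (map φ) := by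
  rw [Ideal.map_map, Ideal.map_span, ← Set.range_comp]
  rfl

lemma systemIdeal_comp {S k : Type*} [CommRing S] [CommRing k] (f : Fin m → Poly n t)
    (φ : ParamPoly t →+* S) (ψ : S →+* k) :
    systemIdeal f (ψ.comp φ) = (systemIdeal f φ).map (map ψ) := by
  rw [systemIdeal, systemIdeal, Ideal.map_span, ← Set.range_comp]
  congr 2
  funext i
  rw [Function.comp_apply, map_map]

/-- The product of the `x`-leading coefficients. -/
noncomputable def lcProd (G : Finset (Poly n t)) : ParamPoly t := ∏ g ∈ G, lcX g

/-- The ring of parametric coefficients in which the `x`-leading coefficients are invertible. -/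
abbrev CoeffRing (G : Finset (Poly n t)) : Type := Localization.Away (lcProd G)

lemma lcX_ne_zero {g : Poly n t} (hg : g ≠ 0) : lcX g ≠ 0 := by
  rw [lcX, ne_eq, MonomialOrder.leadingCoeff_eq_zero_iff]
  simpa using hg

variable {f : Fin m → Poly n t} {G : Finset (Poly n t)}

lemma lcProd_ne_zero (hG : IsReducedGroebnerBasis (elimOrder n t) G (Ideal.span (Set.range f))) :
    lcProd G ≠ 0 :=
  Finset.prod_ne_zero_iff.2 fun _ hg => lcX_ne_zero (hG.ne_zero hg)

lemma isUnit_map_lcX {k : Type*} [CommRing k] {φ : ParamPoly t →+* k}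
    (hφ : IsUnit (φ (lcProd G))) {g : Poly n t} (hg : g ∈ G) : IsUnit (φ (lcX g)) :=
  isUnit_of_dvd_unit (_root_.map_dvd φ (Finset.dvd_prod_of_mem lcX hg)) hφ

lemma exists_normalForm_systemIdeal
    (hG : IsReducedGroebnerBasis (elimOrder n t) G (Ideal.span (Set.range f)))
    {k : Type*} [CommRing k] [Nontrivial k] {φ : ParamPoly t →+* k} (hφ : IsUnit (φ (lcProd G)))
    (p : MvPolynomial (Fin n) k) :
    ∃ r : MvPolynomial (Fin n) k, (∀ a ∈ r.support, a ∈ standardMonomials G) ∧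
      p - r ∈ systemIdeal f φ := by
  rw [systemIdeal_eq_map]
  refine exists_normalForm (grevlex n) φ
    (fun g : G => sumAlgEquiv ℚ (Fin n) (Fin t) (g : Poly n t)) _ (fun g => ?_)
    (fun g => isUnit_map_lcX hφ g.2) _ (fun a => ?_) p
  · refine Ideal.mem_map_of_mem _ ?_
    rw [← hG.1.1]
    exact Ideal.subset_span g.2
  · exact ⟨fun h g => h g g.2, fun h g hg => h ⟨g, hg⟩⟩

/-- Over the ring of coefficients, the quotient algebra is free on the standard monomials. -/
lemma exists_basis_coeffRing
    (hG : IsReducedGroebnerBasis (elimOrder n t) G (Ideal.span (Set.range f))) :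
    ∃ β : Module.Basis (standardMonomials G) (CoeffRing G)
        (MvPolynomial (Fin n) (CoeffRing G) ⧸ systemIdeal f (algebraMap _ (CoeffRing G))),
      ∀ b, β b = monomialFamily _ _ b := by
  have hM : Submonoid.powers (lcProd G) ≤ nonZeroDivisors (ParamPoly t) :=
    powers_le_nonZeroDivisors_of_noZeroDivisors (lcProd_ne_zero hG)
  have : Nontrivial (CoeffRing G) :=
    (IsLocalization.injective (CoeffRing G) hM).nontrivial
  refine ⟨Module.Basis.mk (linearIndependent_monomialFamily _ _ fun r hr hrI => ?_)
    (span_monomialFamily _ _ (exists_normalForm_systemIdeal hG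
      (IsLocalization.Away.algebraMap_isUnit (lcProd G)))), fun b => Module.Basis.mk_apply _ _ b⟩
  rw [systemIdeal_eq_map] at hrI
  refine eq_zero_of_mem_map_of_support_subset (grevlex n) _ hM
    (fun g : G => sumAlgEquiv ℚ (Fin n) (Fin t) (g : Poly n t)) _ (fun p hp hp0 => ?_)
    (standardMonomials G) (fun a => ⟨fun h g => h g g.2, fun h g hg => h ⟨g, hg⟩⟩) hr hrI
  obtain ⟨q, hq, rfl⟩ :=
    (Ideal.mem_map_iff_of_surjective _ (sumAlgEquiv ℚ (Fin n) (Fin t)).surjective).1 hp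
  have hq0 : q ≠ 0 := by
    rintro rfl
    exact hp0 (map_zero _)
  obtain ⟨g, hg, hle⟩ := exists_lmX_le hG.1 hq hq0
  exact ⟨⟨g, hg⟩, hle⟩

/-- Spanning comes from division, as the leading coefficients become units under `φ`; independence
is inherited from `CoeffRing G` through the specialized coordinates. -/
lemma exists_basis_systemIdeal
    (hG : IsReducedGroebnerBasis (elimOrder n t) G (Ideal.span (Set.range f)))
    (β : Module.Basis (standardMonomials G) (CoeffRing G)
        (MvPolynomial (Fin n) (CoeffRing G) ⧸ systemIdeal f (algebraMap _ (CoeffRing G))))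
    (hβ : ∀ b, β b = monomialFamily _ _ b)
    {k : Type*} [CommRing k] [Nontrivial k] {φ : ParamPoly t →+* k} (hφ : IsUnit (φ (lcProd G))) :
    ∃ γ : Module.Basis (standardMonomials G) k (MvPolynomial (Fin n) k ⧸ systemIdeal f φ),
      (∀ b, γ b = monomialFamily _ _ b) ∧
      ∀ p b, γ.repr (Ideal.Quotient.mk _ (map (IsLocalization.Away.lift (lcProd G) hφ) p)) b =
        IsLocalization.Away.lift (lcProd G) hφ (β.repr (Ideal.Quotient.mk _ p) b) := by
  have hcomp : (IsLocalization.Away.lift (lcProd G) hφ).comp (algebraMap _ (CoeffRing G)) = φ :=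
    IsLocalization.Away.lift_comp (lcProd G) hφ
  have hJ : systemIdeal f φ = (systemIdeal f (algebraMap _ (CoeffRing G))).map
      (map (IsLocalization.Away.lift (lcProd G) hφ)) := by
    rw [← systemIdeal_comp, hcomp]
  refine exists_basis_specialize _ β hβ (fun p => ?_) hJ
  rw [← hJ]
  exact exists_normalForm_systemIdeal hG hφ p

end System

end RRC

namespace RRC

open MvPolynomial

/-! ### Finiteness of the set of standard monomials -/

section Finite

/-- For each coordinate, the product of `X i - a i` over the zeros `a` vanishes on the zero locus.
By the Nullstellensatz a power of it lies in `J`, so every coordinate is integral, and a finitely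
generated integral algebra is finite. -/
lemma finite_quotient_of_finite_zeroLocus {k : Type*} [Field k] [IsAlgClosed k] {σ : Type*}
    [Finite σ] (J : Ideal (MvPolynomial σ k)) (hJ : (zeroLocus k J).Finite) :
    Module.Finite k (MvPolynomial σ k ⧸ J) := by
  have hX : ∀ i : σ, IsIntegral k (Ideal.Quotient.mk J (X i)) := by
    intro i
    let q : Polynomial k := ∏ a ∈ hJ.toFinset, (Polynomial.X - Polynomial.C (a i))
    have hq : q.Monic := Polynomial.monic_prod_of_monic _ _ fun a _ => Polynomial.monic_X_sub_C _
    have hrad : Polynomial.aeval (X i : MvPolynomial σ k) q ∈ J.radical := by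
      rw [← vanishingIdeal_zeroLocus_eq_radical (K := k), mem_vanishingIdeal_iff]
      intro a ha
      rw [← Polynomial.aeval_algHom_apply, aeval_X, map_prod]
      refine Finset.prod_eq_zero (hJ.mem_toFinset.2 ha) ?_
      simp
    obtain ⟨N, hN⟩ := hrad
    refine ⟨q ^ N, hq.pow N, ?_⟩
    rw [← Polynomial.aeval_def, ← Ideal.Quotient.mkₐ_eq_mk k, Polynomial.aeval_algHom_apply,
      map_pow, Ideal.Quotient.mkₐ_eq_mk, Ideal.Quotient.eq_zero_iff_mem]
    exact hN
  have hint : Algebra.IsIntegral k (MvPolynomial σ k ⧸ J) := by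
    refine ⟨fun x => ?_⟩
    obtain ⟨p, rfl⟩ := Ideal.Quotient.mk_surjective x
    induction p using MvPolynomial.induction_on with
    | C c => exact isIntegral_algebraMap (A := MvPolynomial σ k ⧸ J) (x := c)
    | add p q hp hq => rw [map_add]; exact hp.add hq
    | mul_X p i hp => rw [map_mul]; exact hp.mul (hX i)
  exact Algebra.IsIntegral.finite

variable {t n m : ℕ}

lemma eval_map_sumAlgEquiv {k : Type*} [CommRing k] [Algebra ℚ k] (η : Fin t → k) (x : Fin n → k)
    (p : Poly n t) :
    eval x (map (aeval η : ParamPoly t →ₐ[ℚ] k).toRingHom (sumAlgEquiv ℚ (Fin n) (Fin t) p)) =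
      aeval (Sum.elim x η) p := by
  induction p using MvPolynomial.induction_on with
  | C c =>
    rw [sumAlgEquiv_C_inl, map_C, eval_C, aeval_C]
    exact aeval_C η c
  | add p q hp hq => simp only [map_add, hp, hq]
  | mul_X p i hp =>
    rw [map_mul, map_mul, map_mul, hp, map_mul]
    rcases i with i | i <;> simp

lemma mem_zeroLocus_systemIdeal {k : Type*} [Field k] [Algebra ℚ k] (f : Fin m → Poly n t)
    (η : Fin t → k) (x : Fin n → k) :
    x ∈ zeroLocus k (systemIdeal f (aeval η : ParamPoly t →ₐ[ℚ] k).toRingHom) ↔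
      ∀ i, aeval (Sum.elim x η) (f i) = 0 := by
  rw [systemIdeal, zeroLocus_span]
  simp only [Set.mem_ofPred_eq, Set.forall_mem_range, MvPolynomial.aeval_eq_eval,
    eval_map_sumAlgEquiv]

variable {f : Fin m → Poly n t} {G : Finset (Poly n t)}

/-- A nonzero polynomial over `ℂ` has a nonvanishing point, so some `η` lies in the given open set
and also avoids the zeros of `lcProd G`. The finite-dimensional algebra of that fibre has the
standard monomials as a basis. -/
theorem finite_standardMonomials (hA : AssumptionA f)
    (hG : IsReducedGroebnerBasis (elimOrder n t) G (Ideal.span (Set.range f))) :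
    (standardMonomials G).Finite := by
  obtain ⟨J, ⟨η₀, hη₀⟩, hJ⟩ := hA
  obtain ⟨h, hhJ, hh⟩ : ∃ h ∈ J, aeval η₀ h ≠ 0 := by
    simpa [mem_zeroLocus_iff] using hη₀
  have hh0 : h ≠ 0 := by
    rintro rfl
    exact hh (map_zero _)
  have hl0 : map (algebraMap ℚ ℂ) (lcProd G) ≠ 0 := by
    rw [ne_eq, map_eq_zero_iff _ (map_injective _ (algebraMap ℚ ℂ).injective)]
    exact lcProd_ne_zero hG
  obtain ⟨η, hη⟩ : ∃ η : Fin t → ℂ, eval η (h * map (algebraMap ℚ ℂ) (lcProd G)) ≠ 0 := by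
    by_contra! hall
    exact mul_ne_zero hh0 hl0 (MvPolynomial.funext fun η => by rw [hall η, map_zero])
  rw [map_mul, eval_map, ← aeval_def] at hη
  have hηJ : η ∈ (zeroLocus ℂ J)ᶜ := fun hmem =>
    left_ne_zero_of_mul hη (by simpa using hmem h hhJ)
  have hφ : IsUnit ((aeval η : ParamPoly t →ₐ[ℚ] ℂ).toRingHom (lcProd G)) :=
    (right_ne_zero_of_mul hη).isUnit
  obtain ⟨β, hβ⟩ := exists_basis_coeffRing hG
  obtain ⟨γ, -⟩ := exists_basis_systemIdeal hG β hβ hφ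
  have hfin : (zeroLocus ℂ (systemIdeal f (aeval η : ParamPoly t →ₐ[ℚ] ℂ).toRingHom)).Finite := by
    refine (hJ η hηJ).2.subset fun x hx => ?_
    exact (mem_zeroLocus_systemIdeal f η x).1 hx
  have := finite_quotient_of_finite_zeroLocus _ hfin
  exact Set.finite_coe_iff.1 (Module.Finite.finite_basis γ)

end Finite

end RRC

namespace RRC

/-! ### Signatures -/

section Signature

/-- Sylvester's law of inertia, in a form with any finite index type, so that diagonal forms indexed
by a sigma type can be used. -/
lemma signature_eq_of_equivalent {δ : ℕ} (S : Matrix (Fin δ) (Fin δ) ℝ) {ι : Type*} [Fintype ι]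
    {w : ι → ℝ} (h : S.toQuadraticForm'.Equivalent (QuadraticMap.weightedSumSquares ℝ w)) :
    signature S = ∑ i, (SignType.sign (w i) : ℤ) := by
  classical
  rw [signature, QuadraticForm.sigPos_of_equiv_weightedSumSquares h,
    QuadraticForm.sigNeg_of_equiv_weightedSumSquares h, Set.ncard_eq_toFinset_card',
    Set.ncard_eq_toFinset_card']
  simp only [Set.toFinset_ofPred, Finset.card_filter]
  push_cast
  rw [← Finset.sum_sub_distrib]
  refine Finset.sum_congr rfl fun i _ => ?_
  rcases lt_trichotomy (w i) 0 with h | h | h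
  · simp [h, h.not_gt]
  · simp [h]
  · simp [h, h.not_gt]

lemma toQuadraticForm'_apply {δ : ℕ} (S : Matrix (Fin δ) (Fin δ) ℝ) (x : Fin δ → ℝ) :
    S.toQuadraticForm' x = x ⬝ᵥ S.mulVec x := by
  simp [Matrix.toQuadraticForm', Matrix.toLinearMap₂'_apply']

lemma equivalent_toQuadraticForm'_transpose_mul_mul {δ : ℕ} (S A : Matrix (Fin δ) (Fin δ) ℝ)
    (hA : IsUnit A.det) :
    (A.transpose * S * A).toQuadraticForm'.Equivalent S.toQuadraticForm' := by
  refine ⟨⟨A.toLinearEquiv' (A.invertibleOfIsUnitDet hA), fun x => ?_⟩⟩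
  change S.toQuadraticForm' (A.mulVec x) = _
  rw [toQuadraticForm'_apply, toQuadraticForm'_apply, ← Matrix.mulVec_mulVec,
    ← Matrix.mulVec_mulVec, Matrix.dotProduct_mulVec x, Matrix.vecMul_transpose]

lemma signature_transpose_mul_mul {δ : ℕ} (S A : Matrix (Fin δ) (Fin δ) ℝ)
    (hA : IsUnit A.det) : signature (A.transpose * S * A) = signature S := by
  have h := equivalent_toQuadraticForm'_transpose_mul_mul S A hA
  rw [signature, signature, h.sigPos_eq, h.sigNeg_eq]

lemma signature_diagonal {δ : ℕ} (w : Fin δ → ℝ) :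
    signature (Matrix.diagonal w) = ∑ i, (SignType.sign (w i) : ℤ) := by
  have h : (Matrix.diagonal w).toQuadraticForm' = QuadraticMap.weightedSumSquares ℝ w := by
    ext x
    rw [toQuadraticForm'_apply, QuadraticMap.weightedSumSquares_apply, dotProduct]
    refine Finset.sum_congr rfl fun i _ => ?_
    rw [Matrix.mulVec_diagonal, smul_eq_mul]
    ring
  exact signature_eq_of_equivalent _ (h ▸ QuadraticMap.Equivalent.refl _)

/-- Jacobi's diagonalization of a symmetric matrix with nonzero leading principal minors. -/
lemma exists_transpose_mul_mul_eq_diagonal {δ : ℕ} (S : Matrix (Fin δ) (Fin δ) ℝ)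
    (hS : S.IsSymm) (h0 : ∀ i, leadingMinor S i ≠ 0) :
    ∃ (A : Matrix (Fin δ) (Fin δ) ℝ) (w : Fin δ → ℝ), A.det = 1 ∧
      A.transpose * S * A = Matrix.diagonal w ∧
      ∀ i, ∏ j ∈ Finset.Iic i, w j = leadingMinor S i := by
  induction δ with
  | zero => exact ⟨1, fun i => i.elim0, by simp, Subsingleton.elim _ _, fun i => i.elim0⟩
  | succ n ih =>
    let e : Fin n ⊕ Fin 1 ≃ Fin (n + 1) := finSumFinEquiv
    let T := S.submatrix e e
    have hT : T.IsSymm := hS.submatrix e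
    have hS' : T.toBlocks₁₁ = S.submatrix Fin.castSucc Fin.castSucc := rfl
    have hsymm : T.toBlocks₁₁.IsSymm := by
      rw [hS']
      exact hS.submatrix _
    have hminor : ∀ i : Fin n, leadingMinor T.toBlocks₁₁ i = leadingMinor S i.castSucc :=
      fun i => rfl
    obtain ⟨A', w', hA', hAw, hw⟩ := ih T.toBlocks₁₁ hsymm fun i => by
      rw [hminor]
      exact h0 _
    -- The determinant of the large block is `1` if the block is empty, and the penultimate leading
    -- minor of `S` otherwise.
    have hdet : IsUnit T.toBlocks₁₁.det := by
      rw [isUnit_iff_ne_zero]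
      cases n with
      | zero => simp
      | succ n => exact h0 (Fin.last n).castSucc
    have h21 : T.toBlocks₂₁ = T.toBlocks₁₂.transpose := by
      ext i j
      exact (hT.apply _ _).symm
    -- This column clears the off-diagonal blocks; `c` below is the Schur complement, the last
    -- diagonal entry.
    let u := -(T.toBlocks₁₁⁻¹ * T.toBlocks₁₂)
    have hu : T.toBlocks₁₁ * u + T.toBlocks₁₂ = 0 := by
      rw [Matrix.mul_neg, Matrix.mul_nonsing_inv_cancel_left _ _ hdet, neg_add_cancel]
    have hu' : u.transpose * T.toBlocks₁₁ + T.toBlocks₂₁ = 0 := by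
      rw [h21, ← hsymm.eq, ← Matrix.transpose_mul, ← Matrix.transpose_add, hu,
        Matrix.transpose_zero]
    let A := Matrix.fromBlocks A' u 0 (1 : Matrix (Fin 1) (Fin 1) ℝ)
    let c := T.toBlocks₂₁ * u + T.toBlocks₂₂
    let w : Fin n ⊕ Fin 1 → ℝ := Sum.elim w' fun i => c i i
    have hprod : A.transpose * T * A = Matrix.diagonal w := by
      have hc : Matrix.diagonal (fun i => c i i) = c := by
        ext i j
        rw [Subsingleton.elim j i, Matrix.diagonal_apply_eq]
      rw [← Matrix.fromBlocks_toBlocks T, Matrix.fromBlocks_transpose, Matrix.mul_assoc,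
        Matrix.fromBlocks_multiply, Matrix.fromBlocks_multiply, ← Matrix.fromBlocks_diagonal, hc,
        ← hAw]
      simp only [Matrix.mul_zero, add_zero, Matrix.mul_one, hu, Matrix.transpose_zero,
        Matrix.zero_mul, zero_add, Matrix.transpose_one, Matrix.one_mul]
      rw [← Matrix.mul_assoc, ← Matrix.mul_assoc, ← Matrix.add_mul, hu', Matrix.zero_mul]
    have hdetA : (A.submatrix e.symm e.symm).det = 1 := by
      rw [Matrix.det_submatrix_equiv_self, Matrix.det_fromBlocks_zero₂₁, hA', Matrix.det_one,
        one_mul]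
    have hmul : (A.submatrix e.symm e.symm).transpose * S * A.submatrix e.symm e.symm =
        Matrix.diagonal (w ∘ e.symm) := by
      have hST : S = T.submatrix e.symm e.symm := by
        ext i j
        simp [T]
      rw [hST, Matrix.transpose_submatrix, Matrix.submatrix_mul_equiv,
        Matrix.submatrix_mul_equiv, hprod, Matrix.submatrix_diagonal_equiv]
    refine ⟨A.submatrix e.symm e.symm, w ∘ e.symm, hdetA, hmul, fun i => ?_⟩
    induction i using Fin.lastCases with
    | last =>
      have : leadingMinor S (Fin.last n) = S.det := rfl
      rw [this, ← Fin.top_eq_last, Finset.Iic_top, ← Matrix.det_diagonal, ← hmul, Matrix.det_mul,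
        Matrix.det_mul, Matrix.det_transpose, hdetA, one_mul, mul_one]
    | cast i =>
      rw [← hminor, ← hw, ← Fin.map_castSuccEmb_Iic, Finset.prod_map]
      refine Finset.prod_congr rfl fun j _ => ?_
      have : e.symm j.castSucc = Sum.inl j := by
        rw [Equiv.symm_apply_eq]
        rfl
      simp [this, w]

/-- The signature of a symmetric matrix is determined by the signs of its leading principal minors,
if these are nonzero. -/
lemma signature_eq_of_sign_leadingMinor_eq {δ : ℕ} {S T : Matrix (Fin δ) (Fin δ) ℝ}
    (hS : S.IsSymm) (hT : T.IsSymm) (h0 : ∀ i, leadingMinor S i ≠ 0)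
    (h : ∀ i, SignType.sign (leadingMinor S i) = SignType.sign (leadingMinor T i)) :
    signature S = signature T := by
  have h0' : ∀ i, leadingMinor T i ≠ 0 := fun i => by
    rw [← sign_ne_zero, ← h, sign_ne_zero]
    exact h0 i
  obtain ⟨A, v, hA, hAv, hv⟩ := exists_transpose_mul_mul_eq_diagonal S hS h0
  obtain ⟨B, w, hB, hBw, hw⟩ := exists_transpose_mul_mul_eq_diagonal T hT h0'
  rw [← signature_transpose_mul_mul S A (by simp [hA]), hAv,
    ← signature_transpose_mul_mul T B (by simp [hB]), hBw, signature_diagonal, signature_diagonal]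
  refine Finset.sum_congr rfl fun i hmem => congrArg _ ?_
  clear hmem
  -- The sign of a minor is that of the product of the diagonal entries up to `i`; the earlier
  -- factors agree by induction, are nonzero, and cancel.
  induction i using WellFoundedLT.induction with
  | _ i ih =>
    have hi := h i
    have hsign : ∀ u : Fin δ → ℝ, SignType.sign (∏ j ∈ Finset.Iio i, u j) =
        ∏ j ∈ Finset.Iio i, SignType.sign (u j) := fun u => map_prod (signHom (α := ℝ)) u _
    have hv0 : ∏ j ∈ Finset.Iic i, v j ≠ 0 := by
      rw [hv]
      exact h0 i
    rw [← hv, ← hw, ← Finset.Iio_insert, Finset.prod_insert Finset.notMem_Iio_self,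
      Finset.prod_insert Finset.notMem_Iio_self, sign_mul, sign_mul, hsign, hsign] at hi
    have hprod : ∏ j ∈ Finset.Iio i, SignType.sign (v j) = ∏ j ∈ Finset.Iio i,
      SignType.sign (w j) := Finset.prod_congr rfl fun j hj => ih j (Finset.mem_Iio.1 hj)
    have hne : ∏ j ∈ Finset.Iio i, SignType.sign (v j) ≠ 0 :=
      Finset.prod_ne_zero_iff.2 fun j hj => by
        rw [sign_ne_zero]
        exact Finset.prod_ne_zero_iff.1 hv0 j (Finset.mem_Iic.2 (Finset.mem_Iio.1 hj).le)
    rw [← hprod] at hi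
    exact mul_right_cancel₀ hne hi

end Signature

end RRC

namespace RRC

/-! ### Hermite's theorem on the trace form -/

section Hermite

lemma trace_pi_apply {K ι : Type*} [Field K] [Fintype ι] {F : ι → Type*} [∀ i, CommRing (F i)]
    [∀ i, Algebra K (F i)] [∀ i, Module.Finite K (F i)] (x : ∀ i, F i) :
    Algebra.trace K (∀ i, F i) x = ∑ i, Algebra.trace K (F i) (x i) := by
  classical
  let b := fun i => Module.finBasis K (F i)
  rw [Algebra.trace_eq_matrix_trace (Pi.basis b), Matrix.trace, Fintype.sum_sigma]
  refine Finset.sum_congr rfl fun i _ => ?_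
  rw [Algebra.trace_eq_matrix_trace (b i), Matrix.trace]
  refine Finset.sum_congr rfl fun j _ => ?_
  rw [Matrix.diag_apply, Matrix.diag_apply, Algebra.leftMulMatrix_eq_repr_mul,
    Algebra.leftMulMatrix_eq_repr_mul, Pi.basis_repr]
  simp

/-- A finite extension of `ℝ` has an orthogonal basis for the trace form, and the signature of the
trace form is the number of embeddings into `ℝ`. -/
lemma exists_basis_trace_mul_self (F : Type*) [Field F] [Algebra ℝ F] [Module.Finite ℝ F] :
    ∃ (d : ℕ) (b : Module.Basis (Fin d) ℝ F) (w : Fin d → ℝ),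
      (∀ x, Algebra.trace ℝ F (x * x) = ∑ j, w j * (b.repr x j * b.repr x j)) ∧
      ∑ j, (SignType.sign (w j) : ℤ) = Nat.card (F →ₐ[ℝ] ℝ) := by
  -- The field is `ℝ`, with form `x²` and one embedding, or `ℂ`, with form `2a² - 2b²`, signature
  -- zero and no embedding.
  rcases Real.nonempty_algEquiv_or F with ⟨⟨e⟩⟩ | ⟨⟨e⟩⟩
  · refine ⟨1, (Module.Basis.singleton (Fin 1) ℝ).map e.symm.toLinearEquiv, fun _ => 1, fun x => ?_,
      ?_⟩
    · rw [← Algebra.trace_eq_of_algEquiv e, map_mul, Algebra.trace_self_apply]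
      simp [Module.Basis.singleton]
    · have : Unique (F →ₐ[ℝ] ℝ) := ⟨⟨e.toAlgHom⟩, fun g => by
        have h : g.comp e.symm.toAlgHom = AlgHom.id ℝ ℝ := Subsingleton.elim _ _
        ext x
        have h2 : g (e.symm (e x)) = e x := DFunLike.congr_fun h (e x)
        rwa [e.symm_apply_apply] at h2⟩
      simp
  · refine ⟨2, Complex.basisOneI.map e.symm.toLinearEquiv, ![2, -2], fun x => ?_, ?_⟩
    · rw [← Algebra.trace_eq_of_algEquiv e, map_mul, Algebra.trace_complex_apply]
      simp [Fin.sum_univ_two, Complex.mul_re]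
      ring
    · have : IsEmpty (F →ₐ[ℝ] ℝ) := ⟨fun g => by
        have h : g (e.symm Complex.I) * g (e.symm Complex.I) = -1 := by
          rw [← map_mul, ← map_mul, Complex.I_mul_I, map_neg, map_neg, map_one, map_one]
        nlinarith [mul_self_nonneg (g (e.symm Complex.I))]⟩
      simp

variable {A : Type*} [CommRing A] [Algebra ℝ A] [Module.Finite ℝ A]

/-- An algebra homomorphism to `ℝ` amounts to a maximal ideal and an embedding of its residue
field. -/
noncomputable def algHomEquivSigma :
    (Σ I : MaximalSpectrum A, (A ⧸ I.asIdeal) →ₐ[ℝ] ℝ) ≃ (A →ₐ[ℝ] ℝ) :=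
  Equiv.ofBijective (fun q => q.2.comp (Ideal.Quotient.mkₐ ℝ q.1.asIdeal)) <| by
    constructor
    · rintro ⟨I, g⟩ ⟨J, h⟩ hgh
      have hker : ∀ (I : MaximalSpectrum A) (g : (A ⧸ I.asIdeal) →ₐ[ℝ] ℝ) (x : A),
          x ∈ I.asIdeal ↔ g.comp (Ideal.Quotient.mkₐ ℝ I.asIdeal) x = 0 := by
        intro I g x
        have := I.isMaximal
        let := Ideal.Quotient.field I.asIdeal
        rw [AlgHom.comp_apply, map_eq_zero, Ideal.Quotient.mkₐ_eq_mk,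
          Ideal.Quotient.eq_zero_iff_mem]
      have hIJ : I = J := by
        apply MaximalSpectrum.ext
        ext x
        rw [hker I g, hker J h]
        exact iff_of_eq (congrArg (· = 0) (DFunLike.congr_fun hgh x))
      subst hIJ
      congr 1
      exact Ideal.Quotient.algHom_ext ℝ hgh
    · intro φ
      have hsurj : Function.Surjective φ := fun c => ⟨algebraMap ℝ A c, by simp⟩
      refine ⟨⟨⟨RingHom.ker φ, RingHom.ker_isMaximal_of_surjective φ hsurj⟩,
        Ideal.Quotient.liftₐ _ φ fun a ha => ha⟩, ?_⟩
      ext x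
      rfl

lemma card_algHom_eq_sum [Fintype (MaximalSpectrum A)] :
    Finite (A →ₐ[ℝ] ℝ) ∧ Nat.card (A →ₐ[ℝ] ℝ) =
      ∑ I : MaximalSpectrum A, Nat.card ((A ⧸ I.asIdeal) →ₐ[ℝ] ℝ) := by
  have hfin : ∀ I : MaximalSpectrum A, Finite ((A ⧸ I.asIdeal) →ₐ[ℝ] ℝ) := by
    intro I
    have := I.isMaximal
    let := Ideal.Quotient.field I.asIdeal
    infer_instance
  refine ⟨Finite.of_equiv _ (algHomEquivSigma (A := A)), ?_⟩
  rw [← Nat.card_congr (algHomEquivSigma (A := A)), Nat.card_sigma]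

/-- **Hermite's theorem**: the signature of the trace form of a reduced finite `ℝ`-algebra is the
number of its real points. -/
theorem signature_trace_eq_card [IsReduced A] {δ : ℕ} (b : Module.Basis (Fin δ) ℝ A) :
    Finite (A →ₐ[ℝ] ℝ) ∧
      signature (Matrix.of fun i j => Algebra.trace ℝ A (b i * b j)) = Nat.card (A →ₐ[ℝ] ℝ) := by
  classical
  have : IsArtinianRing A := IsArtinianRing.of_finite ℝ A
  have := Fintype.ofFinite (MaximalSpectrum A)
  refine ⟨card_algHom_eq_sum.1, ?_⟩
  -- A reduced Artinian ring is the product of its residue fields, so the trace form is an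
  -- orthogonal sum of the forms of the factors.
  let E : A ≃ₐ[ℝ] ∀ I : MaximalSpectrum A, A ⧸ I.asIdeal :=
    (IsArtinianRing.equivPi A).restrictScalars ℝ
  have hbasis : ∀ I : MaximalSpectrum A, ∃ (d : ℕ) (b : Module.Basis (Fin d) ℝ (A ⧸ I.asIdeal))
      (w : Fin d → ℝ), (∀ x, Algebra.trace ℝ (A ⧸ I.asIdeal) (x * x) =
        ∑ j, w j * (b.repr x j * b.repr x j)) ∧
      ∑ j, (SignType.sign (w j) : ℤ) = Nat.card ((A ⧸ I.asIdeal) →ₐ[ℝ] ℝ) := by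
    intro I
    have := I.isMaximal
    let := Ideal.Quotient.field I.asIdeal
    exact exists_basis_trace_mul_self _
  choose d c w hw hsign using hbasis
  rw [card_algHom_eq_sum.2]
  push_cast
  simp_rw [← hsign]
  rw [← Fintype.sum_sigma' (fun (I : MaximalSpectrum A) (j : Fin (d I)) =>
    (SignType.sign (w I j) : ℤ))]
  apply signature_eq_of_equivalent (w := fun q : Σ I : MaximalSpectrum A, Fin (d I) => w q.1 q.2)
  refine ⟨⟨b.equivFun.symm.trans (E.toLinearEquiv.trans (Pi.basis c).equivFun), fun x => ?_⟩⟩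
  have hx : (Matrix.of fun i j => Algebra.trace ℝ A (b i * b j)).toQuadraticForm' x =
      Algebra.trace ℝ A (b.equivFun.symm x * b.equivFun.symm x) := by
    rw [toQuadraticForm'_apply, b.equivFun_symm_apply, Finset.sum_mul_sum, map_sum, dotProduct]
    refine Finset.sum_congr rfl fun i _ => ?_
    rw [map_sum, Matrix.mulVec, dotProduct, Finset.mul_sum]
    refine Finset.sum_congr rfl fun j _ => ?_
    rw [smul_mul_smul_comm, map_smul, Matrix.of_apply, smul_eq_mul]
    ring
  rw [hx, ← Algebra.trace_eq_of_algEquiv E, map_mul, trace_pi_apply,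
    QuadraticMap.weightedSumSquares_apply, Fintype.sum_sigma]
  refine Finset.sum_congr rfl fun I _ => ?_
  rw [Pi.mul_apply, hw]
  refine Finset.sum_congr rfl fun j _ => ?_
  simp [Pi.basis_repr]

end Hermite

end RRC

namespace RRC

open MvPolynomial

/-! ### Connected components of the complement of a hypersurface -/

section Components

/-- Finitely many points of `U` meet every connected component of `U`. -/
def FinitelyManyComponents {X : Type*} [TopologicalSpace X] (U : Set X) : Prop :=
  ∃ F : Finset X, ∀ p ∈ U, ∃ q ∈ F, q ∈ connectedComponentIn U p

/-- The set of points of `Z` below `z` determines the component of `z` in the complement of `Z`. It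
takes finitely many values; one representative is chosen for each. -/
lemma exists_finset_uIcc_disjoint (Z : Finset ℝ) :
    ∃ F : Finset ℝ, ∀ z ∉ Z, ∃ q ∈ F, ∀ y ∈ Set.uIcc z q, y ∉ Z := by
  classical
  let φ : {z : ℝ // z ∉ Z} → Finset ℝ := fun z => Z.filter (· < z)
  have hfin : (Set.range φ).Finite :=
    Z.powerset.finite_toSet.subset (by
      rintro _ ⟨z, rfl⟩
      exact Finset.mem_coe.2 (Finset.mem_powerset.2 (Finset.filter_subset _ _)))
  have := hfin.to_subtype
  have hT := Set.finite_range (Set.rangeSplitting φ)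
  refine ⟨hT.toFinset.image Subtype.val, fun z hz => ?_⟩
  obtain ⟨q, hq, hqz⟩ : ∃ q ∈ Set.range (Set.rangeSplitting φ), φ q = φ ⟨z, hz⟩ :=
    ⟨_, ⟨⟨_, ⟨⟨z, hz⟩, rfl⟩⟩, rfl⟩, Set.apply_rangeSplitting φ _⟩
  refine ⟨q, Finset.mem_image_of_mem _ (hT.mem_toFinset.2 hq), fun y hy hyZ => ?_⟩
  have h1 : y < q ↔ y < z := by
    have := Finset.ext_iff.1 hqz y
    simpa [φ, hyZ] using this
  have hyz : y ≠ z := fun h => hz (h ▸ hyZ)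
  have hyq : y ≠ q := fun h => q.2 (h ▸ hyZ)
  rcases Set.mem_uIcc.1 hy with ⟨h, h'⟩ | ⟨h, h'⟩
  · exact (h1.1 (lt_of_le_of_ne h' hyq)).not_ge h
  · exact (h1.2 (lt_of_le_of_ne h' hyz)).not_ge h

/-! ### Continuous families of real polynomials with simple roots -/

section Family

variable {X : Type*} {F : X → Polynomial ℝ}

/-- Over `V`, every point outside the zero set with height in `J` can be moved vertically, avoiding
the zero set, to a height at which there is no zero over `V`. -/
def MovesVertically (F : X → Polynomial ℝ) (V : Set X) (J : Set ℝ) : Prop :=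
  ∀ x ∈ V, ∀ z ∈ J, (F x).eval z ≠ 0 →
    ∃ z₀, (∀ y ∈ Set.uIcc z z₀, (F x).eval y ≠ 0) ∧ ∀ x' ∈ V, (F x').eval z₀ ≠ 0

lemma MovesVertically.mono {V V' : Set X} {J J' : Set ℝ} (h : MovesVertically F V J) (hV : V' ⊆ V)
    (hJ : J' ⊆ J) : MovesVertically F V' J' := fun x hx z hz h0 => by
  obtain ⟨z₀, h1, h2⟩ := h x (hV hx) z (hJ hz) h0
  exact ⟨z₀, h1, fun x' hx' => h2 x' (hV hx')⟩

lemma MovesVertically.union {V : Set X} {J J' : Set ℝ} (h : MovesVertically F V J)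
    (h' : MovesVertically F V J') : MovesVertically F V (J ∪ J') := by
  rintro x hx z (hz | hz) h0
  · exact h x hx z hz h0
  · exact h' x hx z hz h0

/-- Rolle's theorem. -/
lemma eq_of_eval_eq_zero_of_derivative_ne_zero {p : Polynomial ℝ} {a b y z : ℝ}
    (h : ∀ x ∈ Set.Icc a b, p.derivative.eval x ≠ 0) (hy : y ∈ Set.Icc a b)
    (hz : z ∈ Set.Icc a b) (hy0 : p.eval y = 0) (hz0 : p.eval z = 0) : y = z := by
  have key : ∀ y ∈ Set.Icc a b, ∀ z ∈ Set.Icc a b, p.eval y = 0 → p.eval z = 0 → ¬ y < z := by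
    intro y hy z hz hy0 hz0 hlt
    obtain ⟨c, hc, hc0⟩ := exists_deriv_eq_zero hlt p.continuous.continuousOn (hy0.trans hz0.symm)
    rw [Polynomial.deriv] at hc0
    exact h c ⟨hy.1.trans hc.1.le, hc.2.le.trans hz.2⟩ hc0
  exact le_antisymm (not_lt.1 (key z hz y hy hz0 hy0)) (not_lt.1 (key y hy z hz hy0 hz0))

variable [TopologicalSpace X]

/-- Near a simple root, each nearby polynomial has at most one root in a short interval and none at
its ends. That root cannot lie both above and below the given point, so one of the two ends is
reachable. Near a nonroot, no move is needed. -/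
lemma exists_movesVertically_nhds (hF : Continuous fun p : X × ℝ => (F p.1).eval p.2)
    (hF' : Continuous fun p : X × ℝ => (F p.1).derivative.eval p.2) {x₀ : X}
    (hsimple : ∀ z, (F x₀).eval z = 0 → (F x₀).derivative.eval z ≠ 0) (z₁ : ℝ) :
    ∃ J ∈ nhds z₁, ∃ V ∈ nhds x₀, MovesVertically F V J := by
  by_cases h1 : (F x₀).eval z₁ = 0
  · have hev := hF'.continuousAt.eventually_ne (x := (x₀, z₁)) (hsimple z₁ h1)
    rw [nhds_prod_eq] at hev
    obtain ⟨V, hV, J, hJ, hVJ⟩ := Filter.eventually_prod_iff.1 hev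
    obtain ⟨ε, hε, hεJ⟩ := Metric.nhds_basis_closedBall.mem_iff.1 hJ
    rw [Real.closedBall_eq_Icc] at hεJ
    have hd : ∀ x, V x → ∀ y ∈ Set.Icc (z₁ - ε) (z₁ + ε), (F x).derivative.eval y ≠ 0 :=
      fun x hx y hy => hVJ hx (hεJ hy)
    have hcont : ∀ c : ℝ, Continuous fun x => (F x).eval c := fun c =>
      hF.comp (continuous_id.prodMk continuous_const)
    have hne : ∀ c ∈ Set.Icc (z₁ - ε) (z₁ + ε), c ≠ z₁ → ∀ᶠ x in nhds x₀, (F x).eval c ≠ 0 :=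
      fun c hc hcz => (hcont c).continuousAt.eventually_ne fun h0 =>
        hcz (eq_of_eval_eq_zero_of_derivative_ne_zero (hd x₀ hV.self_of_nhds) hc
          ⟨by linarith, by linarith⟩ h0 h1)
    have hl := hne (z₁ - ε) ⟨by linarith, by linarith⟩ (by linarith)
    have hr := hne (z₁ + ε) ⟨by linarith, by linarith⟩ (by linarith)
    refine ⟨Set.Icc (z₁ - ε) (z₁ + ε), Icc_mem_nhds (by linarith) (by linarith), _,
      hV.and (hl.and hr), ?_⟩
    rintro x ⟨hxV, -, -⟩ z hz hz0
    by_cases hfree : ∀ y ∈ Set.uIcc z (z₁ + ε), (F x).eval y ≠ 0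
    · exact ⟨_, hfree, fun x' hx' => hx'.2.2⟩
    · refine ⟨z₁ - ε, fun y hy hy0 => ?_, fun x' hx' => hx'.2.1⟩
      push Not at hfree
      obtain ⟨y', hy', hy0'⟩ := hfree
      rw [Set.uIcc_of_le hz.2] at hy'
      rw [Set.uIcc_of_ge hz.1] at hy
      have := eq_of_eval_eq_zero_of_derivative_ne_zero (hd x hxV) ⟨hy.1, hy.2.trans hz.2⟩
        ⟨hz.1.trans hy'.1, hy'.2⟩ hy0 hy0'
      have hyz : y = z := le_antisymm hy.2 (this ▸ hy'.1)
      exact hz0 (hyz ▸ hy0)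
  · have hev := hF.continuousAt.eventually_ne (x := (x₀, z₁)) h1
    rw [nhds_prod_eq] at hev
    obtain ⟨V, hV, J, hJ, hVJ⟩ := Filter.eventually_prod_iff.1 hev
    refine ⟨_, hJ, _, hV, fun x hx z hz h0 => ⟨z, fun y hy => ?_, fun x' hx' => hVJ hx' hz⟩⟩
    rw [Set.uIcc_self, Set.mem_singleton_iff] at hy
    rwa [hy]

/-- Compactness of `[-R, R]` merges the local neighbourhoods into one; heights beyond `R` carry no
zeros and stay put. -/
lemma exists_movesVertically_univ (hF : Continuous fun p : X × ℝ => (F p.1).eval p.2)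
    (hF' : Continuous fun p : X × ℝ => (F p.1).derivative.eval p.2) {x₀ : X}
    (hsimple : ∀ z, (F x₀).eval z = 0 → (F x₀).derivative.eval z ≠ 0)
    (hbound : ∃ R, ∀ᶠ x in nhds x₀, ∀ z, R < |z| → (F x).eval z ≠ 0) :
    ∃ V ∈ nhds x₀, MovesVertically F V Set.univ := by
  obtain ⟨R, hR⟩ := hbound
  obtain ⟨V, hV, hVJ⟩ : ∃ V ∈ nhds x₀, MovesVertically F V (Set.Icc (-R) R) := by
    refine isCompact_Icc.induction_on (p := fun J => ∃ V ∈ nhds x₀, MovesVertically F V J) ?_ ?_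
      ?_ ?_
    · exact ⟨Set.univ, Filter.univ_mem, fun x _ z hz => hz.elim⟩
    · rintro J J' hJ ⟨V, hV, h⟩
      exact ⟨V, hV, h.mono subset_rfl hJ⟩
    · rintro J J' ⟨V, hV, h⟩ ⟨V', hV', h'⟩
      exact ⟨V ∩ V', Filter.inter_mem hV hV', (h.mono Set.inter_subset_left subset_rfl).union
        (h'.mono Set.inter_subset_right subset_rfl)⟩
    · intro z _
      obtain ⟨J, hJ, h⟩ := exists_movesVertically_nhds hF hF' hsimple z
      exact ⟨J, mem_nhdsWithin_of_mem_nhds hJ, h⟩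
  refine ⟨_, Filter.inter_mem hV hR, fun x hx z _ h0 => ?_⟩
  by_cases hz : R < |z|
  · refine ⟨z, fun y hy => ?_, fun x' hx' => hx'.2 z hz⟩
    rw [Set.uIcc_self, Set.mem_singleton_iff] at hy
    rwa [hy]
  · exact hVJ.mono Set.inter_subset_left subset_rfl x hx z (abs_le.1 (not_lt.1 hz)) h0

/-- Every connected component of the complement of the zero set over a connected open set `C` meets
every fibre. -/
lemma exists_mem_connectedComponentIn_fibre [LocallyConnectedSpace X]
    (hF : Continuous fun p : X × ℝ => (F p.1).eval p.2) {C : Set X} (hC : IsOpen C)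
    (hCc : IsPreconnected C)
    (hmove : ∀ x₀ ∈ C, ∃ V ∈ nhds x₀, MovesVertically F V Set.univ) {p : X × ℝ}
    (hp : p ∈ {p : X × ℝ | p.1 ∈ C ∧ (F p.1).eval p.2 ≠ 0}) {x : X} (hx : x ∈ C) :
    ∃ z, (x, z) ∈ connectedComponentIn {p : X × ℝ | p.1 ∈ C ∧ (F p.1).eval p.2 ≠ 0} p := by
  set U := {p : X × ℝ | p.1 ∈ C ∧ (F p.1).eval p.2 ≠ 0} with hU
  have hUo : IsOpen U := (hC.preimage continuous_fst).inter (isOpen_ne_fun hF continuous_const)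
  have hKo : IsOpen (connectedComponentIn U p) := hUo.connectedComponentIn
  -- The projection of the component is open; connectedness of `C` reduces the claim to its being
  -- closed relative to `C`.
  have hsub : C ⊆ Prod.fst '' connectedComponentIn U p := by
    refine hCc.subset_of_closure_inter_subset (isOpenMap_fst _ hKo)
      ⟨p.1, hp.1, p, mem_connectedComponentIn hp, rfl⟩ ?_
    rintro x₀ ⟨hcl, hx₀⟩
    obtain ⟨V, hV, hmv⟩ := hmove x₀ hx₀
    obtain ⟨W, hWV, hWo, hxW, hWc⟩ :=
      locallyConnectedSpace_iff_subsets_isOpen_isConnected.1 inferInstance x₀ (V ∩ C)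
        (Filter.inter_mem hV (hC.mem_nhds hx₀))
    obtain ⟨_, hxW', ⟨⟨x, z⟩, hK, rfl⟩⟩ := mem_closure_iff.1 hcl W hWo hxW
    have hxz : (x, z) ∈ U := connectedComponentIn_subset _ _ hK
    obtain ⟨z₀, h1, h2⟩ := hmv x (hWV hxW').1 z trivial hxz.2
    -- An L-shaped set: vertically over `x` to the free height `z₀`, then horizontally over `W` to
    -- `x₀`.
    have hT : IsPreconnected (({x} ×ˢ Set.uIcc z z₀) ∪ (W ×ˢ {z₀})) := by
      refine IsPreconnected.union (x, z₀) ⟨rfl, Set.right_mem_uIcc⟩ ⟨hxW', rfl⟩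
        (isPreconnected_singleton.prod isPreconnected_uIcc)
        (hWc.isPreconnected.prod isPreconnected_singleton)
    have hTU : (({x} ×ˢ Set.uIcc z z₀) ∪ (W ×ˢ {z₀})) ⊆ U := by
      rintro ⟨a, c⟩ (⟨ha, hc⟩ | ⟨ha, hc⟩)
      · simp only [Set.mem_singleton_iff] at ha
        subst ha
        exact ⟨hxz.1, h1 c hc⟩
      · simp only [Set.mem_singleton_iff] at hc
        subst hc
        exact ⟨(hWV ha).2, h2 a (hWV ha).1⟩
    have := hT.subset_connectedComponentIn (x := (x, z)) (Or.inl ⟨rfl, Set.left_mem_uIcc⟩) hTU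
      (Or.inr ⟨hxW, rfl⟩ : (x₀, z₀) ∈ _)
    rw [← connectedComponentIn_eq hK] at this
    exact ⟨_, this, rfl⟩
  obtain ⟨⟨x', z⟩, hz, rfl⟩ := hsub hx
  exact ⟨z, hz⟩

/-- Every component meets the fibre over the fixed `x`, where finitely many roots cut the line into
finitely many intervals. -/
lemma exists_finset_fibre [LocallyConnectedSpace X]
    (hF : Continuous fun p : X × ℝ => (F p.1).eval p.2) {C : Set X} (hC : IsOpen C)
    (hCc : IsPreconnected C)
    (hmove : ∀ x₀ ∈ C, ∃ V ∈ nhds x₀, MovesVertically F V Set.univ) {x : X} (hx : x ∈ C)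
    (hx0 : F x ≠ 0) :
    FinitelyManyComponents {p : X × ℝ | p.1 ∈ C ∧ (F p.1).eval p.2 ≠ 0} := by
  classical
  obtain ⟨T, hT⟩ := exists_finset_uIcc_disjoint (F x).roots.toFinset
  refine ⟨T.image fun z => (x, z), fun p hp => ?_⟩
  obtain ⟨z, hz⟩ := exists_mem_connectedComponentIn_fibre hF hC hCc hmove hp hx
  have hzU := connectedComponentIn_subset _ _ hz
  obtain ⟨q, hq, hzq⟩ := hT z (by simpa [hx0] using hzU.2)
  refine ⟨(x, q), Finset.mem_image_of_mem _ hq, ?_⟩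
  rw [connectedComponentIn_eq hz]
  refine (isPreconnected_singleton.prod isPreconnected_uIcc).subset_connectedComponentIn
    (s := ({x} : Set X) ×ˢ Set.uIcc z q) ⟨Set.mem_singleton x, Set.left_mem_uIcc⟩ ?_
    ⟨Set.mem_singleton x, Set.right_mem_uIcc⟩
  rintro ⟨a, c⟩ ⟨ha, hc⟩
  simp only [Set.mem_singleton_iff] at ha
  subst ha
  exact ⟨hx, by simpa [hx0] using hzq c hc⟩

end Family

end Components
end RRC

namespace RRC

/-! ### Squarefree parts over a domain of characteristic zero -/

section SquarefreePart

open Polynomial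

lemma exists_map_eq_C_mul {A K : Type*} [CommRing A] [IsDomain A] [Field K] [Algebra A K]
    [IsFractionRing A K] (u : K[X]) :
    ∃ d : A, d ≠ 0 ∧ ∃ u₁ : A[X], u₁.map (algebraMap A K) = C (algebraMap A K d) * u := by
  obtain ⟨d, hd, h⟩ := IsLocalization.integerNormalization_spec (nonZeroDivisors A) u
  refine ⟨d, nonZeroDivisors.ne_zero hd, _, h.trans ?_⟩
  rw [Algebra.smul_def]
  rfl

/-- A squarefree part with controlled denominators. -/
lemma exists_squarefreePart {A : Type*} [CommRing A] [IsDomain A] [CharZero A] {q : A[X]}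
    (hq : q ≠ 0) :
    ∃ (s v w a b : A[X]) (d₁ d₂ d₃ : A) (N : ℕ), s ≠ 0 ∧ d₁ ≠ 0 ∧ d₂ ≠ 0 ∧ d₃ ≠ 0 ∧
      C d₁ * q = s * v ∧ C d₂ * s ^ N = q * w ∧ a * s + b * derivative s = C d₃ := by
  let K := FractionRing A
  let ι := algebraMap A K
  have hι : Function.Injective ι := IsFractionRing.injective A K
  have hinj : Function.Injective (Polynomial.map ι) := Polynomial.map_injective ι hι
  have : CharZero K := charZero_of_injective_algebraMap hι
  have hne : ∀ {d : A}, d ≠ 0 → ι d ≠ 0 := fun h => by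
    rwa [ne_eq, map_eq_zero_iff ι hι]
  have hqK : q.map ι ≠ 0 := by
    rwa [ne_eq, Polynomial.map_eq_zero_iff hι]
  -- Over the fraction field, squarefree means separable in characteristic zero, which gives a
  -- Bézout relation with the derivative. The rest clears denominators.
  obtain ⟨s, N, hs, ⟨v, hv⟩, ⟨w, hw⟩⟩ :=
    exists_squarefree_dvd_pow_of_ne_zero hqK
  obtain ⟨a, b, hab⟩ := PerfectField.separable_iff_squarefree.2 hs
  have hclear : ∀ u : K[X], ∃ d : A, d ≠ 0 ∧ ∃ u₁ : A[X], u₁.map ι = C (ι d) * u :=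
    exists_map_eq_C_mul
  obtain ⟨ds, hds, s₁, hs₁⟩ := hclear s
  obtain ⟨dv, hdv, v₁, hv₁⟩ := hclear v
  obtain ⟨dw, hdw, w₁, hw₁⟩ := hclear w
  obtain ⟨da, hda, a₁, ha₁⟩ := hclear a
  obtain ⟨db, hdb, b₁, hb₁⟩ := hclear b
  refine ⟨s₁, v₁, C (ds ^ N) * w₁, C db * a₁, C da * b₁, ds * dv, dw, da * db * ds, N, ?_,
    mul_ne_zero hds hdv, hdw, mul_ne_zero (mul_ne_zero hda hdb) hds, hinj ?_, hinj ?_, hinj ?_⟩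
  · rintro rfl
    rw [Polynomial.map_zero] at hs₁
    rcases mul_eq_zero.1 hs₁.symm with h | h
    · exact hne hds (C_eq_zero.1 h)
    · exact hs.ne_zero h
  · simp only [Polynomial.map_mul, Polynomial.map_C, hs₁, hv₁, hv, map_mul]
    ring
  · simp only [Polynomial.map_mul, Polynomial.map_pow, Polynomial.map_C, hs₁, hw₁, mul_pow, hw,
      map_pow]
    ring
  · simp only [Polynomial.map_mul, Polynomial.map_add, Polynomial.map_C, ha₁, hb₁, hs₁,
      ← Polynomial.derivative_map, derivative_C_mul, map_mul]
    linear_combination C (ι da) * C (ι db) * C (ι ds) * hab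

end SquarefreePart

open MvPolynomial

/-! ### Complements of real hypersurfaces, by induction on the dimension -/

section Hypersurface

/-- Cauchy's root bound, with the maximum of the coefficients weakened to their sum so that it is
visibly continuous in `x`. -/
lemma exists_bound_roots {X : Type*} [TopologicalSpace X] {F : X → Polynomial ℝ} {d : ℕ}
    (hdeg : ∀ x, (F x).natDegree ≤ d) (hc : ∀ i, Continuous fun x => (F x).coeff i) {x₀ : X}
    (h0 : (F x₀).coeff d ≠ 0) :
    ∃ R, ∀ᶠ x in nhds x₀, ∀ z, R < |z| → (F x).eval z ≠ 0 := by
  let β : X → ℝ := fun x => (∑ i ∈ Finset.range d, |(F x).coeff i|) / |(F x).coeff d|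
  have hβ : ContinuousAt β x₀ :=
    (continuous_finsetSum _ fun i _ => (hc i).abs).continuousAt.div (hc d).abs.continuousAt
      (abs_ne_zero.2 h0)
  -- One unit is slack for the variation of `β` near `x₀`, the other is the `+ 1` of Cauchy's bound.
  refine ⟨β x₀ + 1 + 1, ?_⟩
  filter_upwards [hβ.eventually_lt continuousAt_const (lt_add_one (β x₀)),
    (hc d).continuousAt.eventually_ne h0] with x hx hxd z hz hroot
  have hne : F x ≠ 0 := fun h => hxd (by rw [h, Polynomial.coeff_zero])
  have hnd : (F x).natDegree = d := le_antisymm (hdeg x) (Polynomial.le_natDegree_of_ne_zero hxd)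
  have hlt := Polynomial.IsRoot.norm_lt_cauchyBound hne (a := z) hroot
  have hle : ((F x).cauchyBound : ℝ) ≤ β x + 1 := by
    have h : (F x).cauchyBound ≤
        (∑ i ∈ Finset.range d, ‖(F x).coeff i‖₊) / ‖(F x).coeff d‖₊ + 1 := by
      rw [Polynomial.cauchyBound, Polynomial.leadingCoeff, hnd]
      gcongr
      exact Finset.sup_le fun i hi =>
        Finset.single_le_sum (f := fun i => ‖(F x).coeff i‖₊) (fun _ _ => zero_le) hi
    have h' := NNReal.coe_le_coe.2 h
    push_cast at h'
    exact h'
  have : |z| < (F x).cauchyBound := hlt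
  linarith

/-- A polynomial vanishing on a box, a product of infinite sets, is zero. -/
lemma dense_ne_zero {t : ℕ} {P : MvPolynomial (Fin t) ℝ} (hP : P ≠ 0) :
    Dense {x : Fin t → ℝ | eval x P ≠ 0} := by
  rw [dense_iff_inter_open]
  intro U hU ⟨x, hx⟩
  obtain ⟨ε, hε, hεU⟩ := Metric.isOpen_iff.1 hU x hx
  by_contra hempty
  refine hP (funext_set (fun i => Set.Ioo (x i - ε) (x i + ε))
    (fun i => Set.Ioo_infinite (by linarith)) fun y hy => ?_)
  rw [map_zero]
  by_contra hne
  refine hempty ⟨y, hεU ?_, hne⟩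
  rw [Metric.mem_ball, dist_pi_lt_iff hε]
  intro i
  have := hy i trivial
  rw [Real.dist_eq, abs_lt]
  constructor <;> linarith [this.1, this.2]

/-- The complement of a real algebraic hypersurface has finitely many connected components. -/
theorem finitelyManyComponents_ne_zero {t : ℕ} (P : MvPolynomial (Fin t) ℝ) :
    FinitelyManyComponents {x : Fin t → ℝ | eval x P ≠ 0} := by
  classical
  induction t with
  | zero =>
    exact ⟨{0}, fun p hp => ⟨0, Finset.mem_singleton_self _, by
      rw [Subsingleton.elim 0 p]
      exact mem_connectedComponentIn hp⟩⟩
  | succ t ih =>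
    rcases eq_or_ne P 0 with rfl | hP
    · exact ⟨∅, fun p hp => absurd (map_zero _) hp⟩
    have hq : finSuccEquiv ℝ t P ≠ 0 := by simpa using hP
    obtain ⟨s, v, w, a, b, d₁, d₂, d₃, N, hs, hd₁, hd₂, hd₃, h₁, h₂, h₃⟩ :=
      exists_squarefreePart hq
    -- Where `D ≠ 0`: `d₁` and `d₂` give `s` and `P` the same zeros, `d₃` makes the roots of `s`
    -- simple, and the leading coefficient keeps them locally bounded.
    let D := d₁ * d₂ * d₃ * s.leadingCoeff
    have hD : D ≠ 0 := mul_ne_zero (mul_ne_zero (mul_ne_zero hd₁ hd₂) hd₃) (by simpa using hs)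
    have hDx : ∀ x, eval x D ≠ 0 → eval x d₁ ≠ 0 ∧ eval x d₂ ≠ 0 ∧ eval x d₃ ≠ 0 ∧
        eval x s.leadingCoeff ≠ 0 := by
      intro x hx
      simp only [D, map_mul, mul_ne_zero_iff] at hx
      tauto
    let F : (Fin t → ℝ) → Polynomial ℝ := fun x => s.map (eval x)
    have hcont : ∀ u : Polynomial (MvPolynomial (Fin t) ℝ),
        Continuous fun p : (Fin t → ℝ) × ℝ => (u.map (eval p.1)).eval p.2 := by
      intro u
      simp_rw [Polynomial.eval_map, Polynomial.eval₂_eq_sum_range]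
      exact continuous_finsetSum _ fun i _ =>
        ((MvPolynomial.continuous_eval _).comp continuous_fst).mul (continuous_snd.pow i)
    have hF := hcont s
    have hF' : Continuous fun p : (Fin t → ℝ) × ℝ => (F p.1).derivative.eval p.2 := by
      simp_rw [F, Polynomial.derivative_map]
      exact hcont _
    have hroot : ∀ x z, eval x D ≠ 0 →
        ((F x).eval z ≠ 0 ↔ eval (Fin.cons z x : Fin (t + 1) → ℝ) P ≠ 0) := by
      intro x z hx
      obtain ⟨hx₁, hx₂, -, -⟩ := hDx x hx
      have h₁' := congrArg (fun u => (u.map (eval x)).eval z) h₁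
      have h₂' := congrArg (fun u => (u.map (eval x)).eval z) h₂
      simp only [Polynomial.map_mul, Polynomial.map_C, Polynomial.map_pow, Polynomial.eval_mul,
        Polynomial.eval_C, Polynomial.eval_pow, ← eval_eq_eval_mv_eval'] at h₁' h₂'
      refine not_congr ⟨fun h => ?_, fun h => ?_⟩
      · rw [show (s.map (eval x)).eval z = 0 from h, zero_mul] at h₁'
        exact (mul_eq_zero.1 h₁').resolve_left hx₁
      · rw [h, zero_mul] at h₂'
        exact eq_zero_of_pow_eq_zero ((mul_eq_zero.1 h₂').resolve_left hx₂)
    have hmove : ∀ x₀, eval x₀ D ≠ 0 → ∃ V ∈ nhds x₀, MovesVertically F V Set.univ := by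
      intro x₀ hx₀
      obtain ⟨-, -, hx₃, hx₄⟩ := hDx x₀ hx₀
      refine exists_movesVertically_univ hF hF' (fun z hz hz' => hx₃ ?_)
        (exists_bound_roots (F := F) (d := s.natDegree) (fun x => Polynomial.natDegree_map_le)
          (fun i => ?_) ?_)
      · have h₃' := congrArg (fun u => (u.map (eval x₀)).eval z) h₃
        simp only [Polynomial.map_mul, Polynomial.map_C, Polynomial.map_add, Polynomial.eval_mul,
          Polynomial.eval_C, Polynomial.eval_add, ← Polynomial.derivative_map] at h₃'
        rw [← h₃', show (s.map (eval x₀)).eval z = 0 from hz,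
          show (s.map (eval x₀)).derivative.eval z = 0 from hz', mul_zero, mul_zero, add_zero]
      · simp only [F, Polynomial.coeff_map]
        exact MvPolynomial.continuous_eval _
      · simpa [F, Polynomial.coeff_map] using hx₄
    have hDo : IsOpen {x : Fin t → ℝ | eval x D ≠ 0} :=
      isOpen_ne_fun (MvPolynomial.continuous_eval D) continuous_const
    have hfib : ∀ x₁, FinitelyManyComponents {p : (Fin t → ℝ) × ℝ |
        p.1 ∈ connectedComponentIn {x : Fin t → ℝ | eval x D ≠ 0} x₁ ∧
          (F p.1).eval p.2 ≠ 0} := by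
      intro x₁
      by_cases hx₁ : eval x₁ D ≠ 0
      · refine exists_finset_fibre hF hDo.connectedComponentIn isPreconnected_connectedComponentIn
          (fun x hx => hmove x (connectedComponentIn_subset _ _ hx))
          (mem_connectedComponentIn hx₁) fun h0 => (hDx x₁ hx₁).2.2.2 ?_
        have := congrArg (fun u => Polynomial.coeff u s.natDegree) h0
        simpa [F, Polynomial.coeff_map] using this
      · refine ⟨∅, fun p hp => ?_⟩
        rw [connectedComponentIn_eq_empty (F := {x : Fin t → ℝ | eval x D ≠ 0}) hx₁] at hp
        exact hp.1.elim
    choose T hT using hfib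
    obtain ⟨F₀, hF₀⟩ := ih D
    let Φ : (Fin t → ℝ) × ℝ → Fin (t + 1) → ℝ := fun p => Fin.cons p.2 p.1
    have hΦ : Continuous Φ := by
      refine continuous_pi fun i => ?_
      induction i using Fin.cases with
      | zero => exact continuous_snd
      | succ i => exact (continuous_apply i).comp continuous_fst
    refine ⟨(F₀.biUnion T).image Φ, fun p hp => ?_⟩
    have hKo : IsOpen (connectedComponentIn {x : Fin (t + 1) → ℝ | eval x P ≠ 0} p) :=
      (isOpen_ne_fun (MvPolynomial.continuous_eval P) continuous_const).connectedComponentIn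
    have hDr : rename Fin.succ D ≠ 0 := by
      rwa [ne_eq, map_eq_zero_iff _ (rename_injective _ (Fin.succ_injective t))]
    -- Each component is open, so it contains a point over `D ≠ 0`; no component is lost by
    -- restricting to the cylinders over the finitely many components supplied by induction.
    obtain ⟨y, hyD, hyK⟩ := (dense_ne_zero hDr).exists_mem_open hKo
      ⟨p, mem_connectedComponentIn hp⟩
    have hyD' : eval (Fin.tail y) D ≠ 0 := by
      rw [Set.mem_ofPred_eq, eval_rename] at hyD
      exact hyD
    have hy : Φ (Fin.tail y, y 0) = y := Fin.cons_self_tail y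
    obtain ⟨x₁, hx₁, hx₁y⟩ := hF₀ (Fin.tail y) hyD'
    have hmem : (Fin.tail y, y 0) ∈ {p : (Fin t → ℝ) × ℝ |
        p.1 ∈ connectedComponentIn {x : Fin t → ℝ | eval x D ≠ 0} x₁ ∧
          (F p.1).eval p.2 ≠ 0} := by
      refine ⟨?_, (hroot _ _ hyD').2 ?_⟩
      · rw [← connectedComponentIn_eq hx₁y]
        exact mem_connectedComponentIn hyD'
      · rw [← hy] at hyK
        exact connectedComponentIn_subset _ _ hyK
    obtain ⟨q, hqT, hq⟩ := hT x₁ _ hmem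
    refine ⟨Φ q, Finset.mem_image_of_mem _ (Finset.mem_biUnion.2 ⟨x₁, hx₁, hqT⟩), ?_⟩
    rw [connectedComponentIn_eq hyK]
    refine (isPreconnected_connectedComponentIn.image Φ hΦ.continuousOn).subset_connectedComponentIn
      ⟨_, mem_connectedComponentIn hmem, hy⟩ ?_ ⟨q, hq, rfl⟩
    rintro _ ⟨r, hr, rfl⟩
    obtain ⟨hr₁, hr₂⟩ := connectedComponentIn_subset _ _ hr
    exact (hroot _ _ (connectedComponentIn_subset _ _ hr₁)).1 hr₂

end Hypersurface

end RRC

namespace RRC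

open MvPolynomial

/-! ### Nondegeneracy of the trace form -/

section TraceForm

variable {K A : Type*} [Field K] [CommRing A] [Algebra K A]

/-- The descending powers of `x` stabilize, and reducedness turns this into `x = x²z`. Then `xz` is
idempotent, so the trace of multiplication by it is the rank of its image, which contains `x`; in
characteristic zero this is nonzero. -/
lemma exists_trace_mul_ne_zero [Module.Finite K A] [CharZero K] [IsReduced A] {x : A} (hx : x ≠ 0) :
    ∃ y, Algebra.trace K A (x * y) ≠ 0 := by
  have : IsArtinianRing A := IsArtinianRing.of_finite K A
  obtain ⟨n, z, hz⟩ := IsArtinian.exists_pow_succ_smul_dvd x (1 : A)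
  have hxz : x * (1 - x * z) = 0 := by
    refine pow_eq_zero_iff (n := n + 1) n.succ_ne_zero |>.1 ?_
    rw [smul_eq_mul, smul_eq_mul, mul_one] at hz
    rw [mul_pow, pow_succ (1 - x * z)]
    calc x ^ (n + 1) * ((1 - x * z) ^ n * (1 - x * z))
        = (x ^ n - x ^ n.succ * z) * (x * (1 - x * z) ^ n) := by rw [Nat.succ_eq_add_one]; ring
      _ = 0 := by rw [hz, sub_self, zero_mul]
  have he : (x * z) * (x * z) = x * z := by
    linear_combination -z * hxz
  refine ⟨z, ?_⟩
  have hidem : IsIdempotentElem (Algebra.lmul K A (x * z)) := by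
    rw [IsIdempotentElem, ← map_mul, he]
  have hmem : x ∈ LinearMap.range (Algebra.lmul K A (x * z)) := by
    refine ⟨x, ?_⟩
    change x * z * x = x
    linear_combination -hxz
  have hpos : 0 < Module.finrank K (LinearMap.range (Algebra.lmul K A (x * z))) :=
    Module.finrank_pos_iff_exists_ne_zero.2 ⟨⟨x, hmem⟩, fun h => hx (congrArg Subtype.val h)⟩
  rw [Algebra.trace_apply, LinearMap.IsProj.trace (LinearMap.IsIdempotentElem.isProj_range _ hidem)]
  exact Nat.cast_ne_zero.2 hpos.ne'

lemma traceMatrix_det_ne_zero [CharZero K] [IsReduced A]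
    {ι : Type*} [Fintype ι] [DecidableEq ι]
    (b : Module.Basis ι K A) : (Algebra.traceMatrix K b).det ≠ 0 := by
  have := Module.Finite.of_basis b
  rw [Algebra.traceMatrix_of_basis, ← LinearMap.BilinForm.nondegenerate_iff_det_ne_zero]
  refine LinearMap.BilinForm.Nondegenerate.ofSeparatingLeft fun x hx => ?_
  by_contra hne
  obtain ⟨y, hy⟩ := exists_trace_mul_ne_zero (K := K) hne
  exact hy (hx y)

/-- Multiples of a nilpotent element are nilpotent and have trace zero, so nilpotents lie in the
kernel of the trace form. -/
lemma isReduced_of_traceMatrix_det_ne_zero {ι : Type*} [Fintype ι] [DecidableEq ι]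
    (b : Module.Basis ι K A) (h : (Algebra.traceMatrix K b).det ≠ 0) : IsReduced A := by
  rw [Algebra.traceMatrix_of_basis, ← LinearMap.BilinForm.nondegenerate_iff_det_ne_zero] at h
  refine ⟨fun x hx => h.1 x fun y => ?_⟩
  rw [Algebra.traceForm_apply, Algebra.trace_apply]
  exact (LinearMap.isNilpotent_trace_of_isNilpotent
    (((Commute.all x y).isNilpotent_mul_right hx).map (Algebra.lmul K A))).eq_zero

end TraceForm

/-! ### Reducedness of the generic fibre -/

section Radical

variable {t n m : ℕ} {f : Fin m → Poly n t}

/-- Passing to `K[x]` is localization at the nonzero polynomials in `y`, and localization commutes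
with radicals. -/
lemma isReduced_quotient_systemIdeal (hrad : (Ideal.span (Set.range f)).IsRadical)
    {K : Type*} [Field K] [Algebra (ParamPoly t) K] [IsFractionRing (ParamPoly t) K] :
    IsReduced (MvPolynomial (Fin n) K ⧸ systemIdeal f (algebraMap (ParamPoly t) K)) := by
  rw [← Ideal.isRadical_iff_quotient_reduced, systemIdeal_eq_map]
  let : Algebra (MvPolynomial (Fin n) (ParamPoly t)) (MvPolynomial (Fin n) K) := algebraMvPolynomial
  have hloc := MvPolynomial.isLocalization (σ := Fin n) (nonZeroDivisors (ParamPoly t)) K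
  let ψ : Poly n t →+* MvPolynomial (Fin n) (ParamPoly t) := sumAlgEquiv ℚ (Fin n) (Fin t)
  have hker : RingHom.ker ψ ≤ Ideal.span (Set.range f) := by
    rw [(RingHom.injective_iff_ker_eq_bot ψ).1 (sumAlgEquiv ℚ (Fin n) (Fin t)).injective]
    exact bot_le
  have h1 := Ideal.map_radical_of_surjective (f := ψ) (sumAlgEquiv ℚ (Fin n) (Fin t)).surjective
    hker
  have h2 := IsLocalization.map_radical ((nonZeroDivisors (ParamPoly t)).map
    (C : _ →+* MvPolynomial (Fin n) (ParamPoly t))) (MvPolynomial (Fin n) K)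
    ((Ideal.span (Set.range f)).map ψ)
  rw [← h1, hrad.radical] at h2
  exact h2 ▸ Ideal.radical_isRadical _

end Radical

/-! ### Generic matrices -/

section Generic

lemma leadingMinor_map {R S : Type} [CommRing R] [CommRing S] (φ : R →+* S) {δ : ℕ}
    (M : Matrix (Fin δ) (Fin δ) R) (i : Fin δ) :
    leadingMinor (M.map φ) i = φ (leadingMinor M i) := by
  rw [leadingMinor, leadingMinor, RingHom.map_det]
  rfl

lemma map_transpose_mul_mul {R S : Type} [CommRing R] [CommRing S] (φ : R →+* S) {δ : ℕ}
    (A H : Matrix (Fin δ) (Fin δ) R) :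
    (A.transpose * H * A).map φ = (A.map φ).transpose * H.map φ * A.map φ := by
  rw [Matrix.map_mul, Matrix.map_mul, Matrix.transpose_map]

/-- An orthogonal basis makes the matrix diagonal with nonzero entries; its leading minors are
partial products of them. -/
lemma exists_leadingMinor_ne_zero {K : Type} [Field K] [CharZero K] {δ : ℕ}
    {H : Matrix (Fin δ) (Fin δ) K} (hH : H.IsSymm) (hdet : H.det ≠ 0) :
    ∃ A : Matrix (Fin δ) (Fin δ) K, ∀ i, leadingMinor (A.transpose * H * A) i ≠ 0 := by
  have : Invertible (2 : K) := invertibleOfNonzero two_ne_zero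
  let B := Matrix.toBilin' H
  have hB : B.IsSymm := Matrix.isSymm_toBilin'_iff_isSymm.2 hH
  obtain ⟨v, hv⟩ := LinearMap.BilinForm.exists_orthogonal_basis (B := B) ⟨hB.eq⟩
  let v' := v.reindex (finCongr (Module.finrank_fin_fun K))
  let P := (Pi.basisFun K (Fin δ)).toMatrix v'
  have hP : P.transpose * H * P = Matrix.diagonal fun i => B (v' i) (v' i) := by
    have hH' : H = LinearMap.BilinForm.toMatrix (Pi.basisFun K (Fin δ)) B := by
      rw [LinearMap.BilinForm.toMatrix_basisFun]
      exact (LinearMap.BilinForm.toMatrix'_toBilin' H).symm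
    rw [hH', LinearMap.BilinForm.toMatrix_mul_basis_toMatrix]
    ext i j
    rw [LinearMap.BilinForm.toMatrix_apply]
    by_cases hij : i = j
    · subst hij
      rw [Matrix.diagonal_apply_eq]
    · rw [Matrix.diagonal_apply_ne _ hij, Module.Basis.reindex_apply, Module.Basis.reindex_apply]
      exact hv fun h => hij ((finCongr _).symm.injective h)
  have hPdet : P.det ≠ 0 := by
    have := (Pi.basisFun K (Fin δ)).invertibleToMatrix v'
    exact (Matrix.isUnit_det_of_invertible P).ne_zero
  refine ⟨P, fun i => ?_⟩
  have hd := congrArg Matrix.det hP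
  rw [Matrix.det_mul, Matrix.det_mul, Matrix.det_transpose, Matrix.det_diagonal] at hd
  have hne : ∏ i, B (v' i) (v' i) ≠ 0 := by
    rw [← hd]
    exact mul_ne_zero (mul_ne_zero hPdet hdet) hPdet
  rw [hP, leadingMinor, Matrix.submatrix_diagonal _ _ (Fin.castLE_injective _), Matrix.det_diagonal]
  exact Finset.prod_ne_zero_iff.2 fun j _ => Finset.prod_ne_zero_iff.1 hne _ (Finset.mem_univ _)

/-- The minors for a matrix of indeterminates are nonzero polynomials, having nonzero values over
`K`. If `P` vanishes at all good `A`, then `P` times the determinant times these minors vanishes at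
every rational point, hence identically, as `ℚ` is infinite. -/
theorem zariskiDenseGL_leadingMinor {K : Type} [Field K] [Algebra ℚ K] {δ : ℕ}
    {H : Matrix (Fin δ) (Fin δ) K} (hH : H.IsSymm) (hdet : H.det ≠ 0) :
    ZariskiDenseGL {A : GL (Fin δ) ℚ | ∀ i, leadingMinor
      (((A : Matrix (Fin δ) (Fin δ) ℚ).map (algebraMap ℚ K)).transpose * H *
        (A : Matrix (Fin δ) (Fin δ) ℚ).map (algebraMap ℚ K)) i ≠ 0} := by
  have : CharZero K := charZero_of_injective_algebraMap (algebraMap ℚ K).injective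
  intro P hP
  let X := Matrix.mvPolynomialX (Fin δ) (Fin δ) K
  let N := leadingMinor (X.transpose * H.map (C : K →+* MvPolynomial (Fin δ × Fin δ) K) * X)
  have hX : ∀ a : Fin δ × Fin δ → K, X.map (eval a) = Matrix.of fun i j => a (i, j) := by
    intro a
    ext i j
    simp [X]
  have hN : ∀ (a : Fin δ × Fin δ → K) i, eval a (N i) = leadingMinor
      ((Matrix.of fun i j => a (i, j)).transpose * H * Matrix.of fun i j => a (i, j)) i := by
    intro a i
    rw [← leadingMinor_map, map_transpose_mul_mul, hX]
    congr
    ext i j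
    simp
  have hN0 : ∀ i, N i ≠ 0 := by
    intro i h0
    obtain ⟨A, hA⟩ := exists_leadingMinor_ne_zero hH hdet
    apply hA i
    have := hN (fun p => A p.1 p.2) i
    rw [h0, map_zero] at this
    exact this.symm
  have hmap0 : map (algebraMap ℚ K) P * (X.det * ∏ i, N i) = 0 := by
    refine funext_set (fun _ => Set.range (algebraMap ℚ K))
      (fun _ => Set.infinite_range_of_injective (algebraMap ℚ K).injective) fun x hx => ?_
    choose a ha using fun p => hx p trivial
    obtain rfl : (fun p => algebraMap ℚ K (a p)) = x := funext ha
    rw [map_zero]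
    by_contra hne
    rw [map_mul, map_mul, map_prod, ← ne_eq, mul_ne_zero_iff, mul_ne_zero_iff] at hne
    obtain ⟨h1, h2, h3⟩ := hne
    let A : Matrix (Fin δ) (Fin δ) ℚ := Matrix.of fun i j => a (i, j)
    have hAm : A.map (algebraMap ℚ K) = Matrix.of fun i j => algebraMap ℚ K (a (i, j)) := rfl
    have hdetA : A.det ≠ 0 := by
      intro h0
      apply h2
      rw [RingHom.map_det]
      change (X.map _).det = 0
      rw [hX, ← hAm]
      change ((algebraMap ℚ K).mapMatrix A).det = 0
      rw [← RingHom.map_det, h0, map_zero]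
    have h4 := hP (Matrix.GeneralLinearGroup.mkOfDetNeZero A hdetA) fun i => by
      have := Finset.prod_ne_zero_iff.1 h3 i (Finset.mem_univ i)
      rwa [hN] at this
    apply h1
    have h5 := aeval_algebraMap_apply K a P
    rw [aeval_def, ← eval_map] at h5
    refine h5.trans ?_
    rw [aeval_eq_eval]
    exact (congrArg _ h4).trans (map_zero _)
  have hP0 : P = 0 := by
    have h := (mul_eq_zero.1 hmap0).resolve_right
      (mul_ne_zero (Matrix.det_mvPolynomialX_ne_zero _ _)
        (Finset.prod_ne_zero_iff.2 fun i _ => hN0 i))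
    rwa [map_eq_zero_iff _ (map_injective _ (algebraMap ℚ K).injective)] at h
  intro A
  rw [hP0, map_zero]

end Generic

end RRC

namespace RRC

open MvPolynomial

/-! ### Specialization of Hermite matrices -/

section Evaluation

variable {t n m δ : ℕ} {f : Fin m → Poly n t} {G : Finset (Poly n t)}

/-- The Hermite matrix of the specialization of the system along `φ`. -/
noncomputable def hermiteAt {k : Type} [CommRing k] (f : Fin m → Poly n t) (φ : ParamPoly t →+* k)
    (b : Fin δ → (Fin n →₀ ℕ)) : Matrix (Fin δ) (Fin δ) k :=
  Matrix.of fun i j => Algebra.trace k (MvPolynomial (Fin n) k ⧸ systemIdeal f φ)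
    (Ideal.Quotient.mk _ (monomial (b i) 1 * monomial (b j) 1))

/-- The Hermite matrix over the ring of coefficients. -/
noncomputable def hermiteCoeff (f : Fin m → Poly n t) (G : Finset (Poly n t))
    (b : Fin δ → (Fin n →₀ ℕ)) : Matrix (Fin δ) (Fin δ) (CoeffRing G) :=
  hermiteAt f (algebraMap _ (CoeffRing G)) b

lemma hermiteAt_isSymm {k : Type} [CommRing k] (φ : ParamPoly t →+* k)
    (b : Fin δ → (Fin n →₀ ℕ)) : (hermiteAt f φ b).IsSymm := by
  ext i j
  rw [Matrix.transpose_apply, hermiteAt, Matrix.of_apply, Matrix.of_apply, mul_comm]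

lemma hermiteAt_eq_traceMatrix {k : Type} [CommRing k] {φ : ParamPoly t →+* k}
    (b : Fin δ ≃ standardMonomials G)
    {γ : Module.Basis (standardMonomials G) k (MvPolynomial (Fin n) k ⧸ systemIdeal f φ)}
    (hγ : ∀ b, γ b = monomialFamily _ _ b) :
    hermiteAt f φ (fun j => (b j : Fin n →₀ ℕ)) =
      Algebra.traceMatrix k (γ.reindex b.symm) := by
  ext i j
  rw [hermiteAt, Matrix.of_apply, Algebra.traceMatrix_apply, Algebra.traceForm_apply,
    γ.reindex_apply, γ.reindex_apply, hγ, hγ, map_mul]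
  rfl

/-- Used both for the embedding into `𝕂` and for evaluation at real points, which ties the
parametric matrix to the matrices of the fibres. -/
lemma map_hermiteCoeff (hG : IsReducedGroebnerBasis (elimOrder n t) G (Ideal.span (Set.range f)))
    {k : Type} [CommRing k] [Nontrivial k] {φ : ParamPoly t →+* k} (hφ : IsUnit (φ (lcProd G)))
    (hfin : (standardMonomials G).Finite) (b : Fin δ → (Fin n →₀ ℕ)) :
    (hermiteCoeff f G b).map (IsLocalization.Away.lift (lcProd G) hφ) = hermiteAt f φ b := by
  obtain ⟨β, hβ⟩ := exists_basis_coeffRing hG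
  obtain ⟨γ, hγ, hrepr⟩ := exists_basis_systemIdeal hG β hβ hφ
  have := hfin.to_subtype
  ext i j
  rw [Matrix.map_apply, hermiteCoeff, hermiteAt, hermiteAt, Matrix.of_apply, Matrix.of_apply,
    ← trace_specialize _ β hβ γ hγ hrepr, map_mul, map_monomial, map_monomial, map_one]

/-- The leading principal minors of `Aᵀ H A` over the ring of coefficients. -/
noncomputable def minorsCoeff (f : Fin m → Poly n t) (G : Finset (Poly n t))
    (b : Fin δ → (Fin n →₀ ℕ)) (A : Matrix (Fin δ) (Fin δ) ℚ) : Fin δ → CoeffRing G :=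
  leadingMinor ((A.map (algebraMap ℚ (CoeffRing G))).transpose * hermiteCoeff f G b *
    A.map (algebraMap ℚ (CoeffRing G)))

lemma lift_minorsCoeff (hG : IsReducedGroebnerBasis (elimOrder n t) G (Ideal.span (Set.range f)))
    {k : Type} [CommRing k] [Nontrivial k] [Algebra ℚ k] {φ : ParamPoly t →+* k}
    (hφ : IsUnit (φ (lcProd G))) (hfin : (standardMonomials G).Finite)
    (b : Fin δ → (Fin n →₀ ℕ)) (A : Matrix (Fin δ) (Fin δ) ℚ) (i : Fin δ) :
    IsLocalization.Away.lift (lcProd G) hφ (minorsCoeff f G b A i) =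
      leadingMinor ((A.map (algebraMap ℚ k)).transpose * hermiteAt f φ b *
        A.map (algebraMap ℚ k)) i := by
  have hA : (A.map (algebraMap ℚ (CoeffRing G))).map (IsLocalization.Away.lift (lcProd G) hφ) =
      A.map (algebraMap ℚ k) := by
    rw [Matrix.map_map]
    congr 1
    exact congrArg DFunLike.coe (Subsingleton.elim
      ((IsLocalization.Away.lift (lcProd G) hφ).comp (algebraMap ℚ (CoeffRing G)))
      (algebraMap ℚ k))
  rw [minorsCoeff, ← leadingMinor_map, map_transpose_mul_mul, map_hermiteCoeff hG hφ hfin, hA]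

/-- Evaluation of parametric coefficients at a real point. -/
noncomputable abbrev evalHom (η : Fin t → ℝ) : ParamPoly t →+* ℝ :=
  (aeval η : ParamPoly t →ₐ[ℚ] ℝ).toRingHom

lemma isUnit_evalHom_lcProd {η : Fin t → ℝ} (hη : (aeval η (lcProd G) : ℝ) ≠ 0) :
    IsUnit (evalHom η (lcProd G)) := isUnit_iff_ne_zero.2 hη

lemma isUnit_algebraMap_lcProd
    (hG : IsReducedGroebnerBasis (elimOrder n t) G (Ideal.span (Set.range f))) :
    IsUnit (algebraMap (ParamPoly t) (ParamField t) (lcProd G)) := by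
  rw [isUnit_iff_ne_zero, ne_eq, IsFractionRing.to_map_eq_zero_iff]
  exact lcProd_ne_zero hG

/-- A rational function whose denominator divides a power of a polynomial that does not vanish at
`η` is defined at `η`, with the expected value. -/
lemma definedAt_and_evalAt_eq {r : ParamField t} {a d : ParamPoly t} {η : Fin t → ℝ}
    (hr : r * algebraMap _ _ d = algebraMap _ _ a) (hd : (aeval η d : ℝ) ≠ 0) :
    DefinedAt r η ∧ evalAt r η * aeval η d = aeval η a := by
  have hden : algebraMap (ParamPoly t) (ParamField t)
      (IsFractionRing.den (ParamPoly t) r : ParamPoly t) ≠ 0 := by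
    rw [ne_eq, IsFractionRing.to_map_eq_zero_iff]
    exact nonZeroDivisors.coe_ne_zero _
  have heq : IsFractionRing.num (ParamPoly t) r * d =
      a * (IsFractionRing.den (ParamPoly t) r : ParamPoly t) := by
    apply IsFractionRing.injective (ParamPoly t) (ParamField t)
    rw [map_mul, map_mul, ← hr]
    have h := IsFractionRing.mk'_num_den' (ParamPoly t) r
    rw [div_eq_iff hden] at h
    rw [h]
    ring
  -- The denominator is coprime to the numerator and divides its product with `d`.
  have hdvd : (IsFractionRing.den (ParamPoly t) r : ParamPoly t) ∣ d :=
    (IsFractionRing.num_den_reduced (ParamPoly t) r).symm.dvd_of_dvd_mul_left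
      (heq ▸ dvd_mul_left _ _)
  have hdef : DefinedAt r η := fun h0 => by
    obtain ⟨c, hc⟩ := hdvd
    rw [hc, map_mul, h0, zero_mul] at hd
    exact hd rfl
  refine ⟨hdef, ?_⟩
  have := congrArg (aeval η : ParamPoly t →ₐ[ℚ] ℝ) heq
  rw [map_mul, map_mul] at this
  rw [evalAt, div_mul_eq_mul_div, div_eq_iff hdef, this]

/-- An element of `CoeffRing G` is a polynomial over a power of `lcProd G`, so evaluating its
reduced fraction at `η` agrees with the ring map to `ℝ`. -/
lemma definedAt_lift (hK : IsUnit (algebraMap (ParamPoly t) (ParamField t) (lcProd G)))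
    {η : Fin t → ℝ} (hη : (aeval η (lcProd G) : ℝ) ≠ 0) (r : CoeffRing G) :
    DefinedAt (IsLocalization.Away.lift (lcProd G) hK r) η ∧
      evalAt (IsLocalization.Away.lift (lcProd G) hK r) η =
        IsLocalization.Away.lift (lcProd G) (isUnit_evalHom_lcProd hη) r := by
  obtain ⟨N, a, ha⟩ := IsLocalization.Away.surj (lcProd G) r
  rw [← map_pow] at ha
  have h1 := congrArg (IsLocalization.Away.lift (lcProd G) hK) ha
  rw [map_mul, IsLocalization.Away.lift_eq, IsLocalization.Away.lift_eq] at h1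
  have h2 := congrArg (IsLocalization.Away.lift (lcProd G) (isUnit_evalHom_lcProd hη)) ha
  rw [map_mul, IsLocalization.Away.lift_eq, IsLocalization.Away.lift_eq] at h2
  have hN : (aeval η (lcProd G ^ N) : ℝ) ≠ 0 := by
    rw [map_pow]
    exact pow_ne_zero _ hη
  obtain ⟨h3, h4⟩ := definedAt_and_evalAt_eq h1 hN
  exact ⟨h3, mul_right_cancel₀ hN (h4.trans h2.symm)⟩

lemma hermite_map_evalAt
    (hG : IsReducedGroebnerBasis (elimOrder n t) G (Ideal.span (Set.range f)))
    (hfin : (standardMonomials G).Finite) (b : Fin δ → (Fin n →₀ ℕ))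
    {η : Fin t → ℝ} (hη : (aeval η (lcProd G) : ℝ) ≠ 0) :
    (hermite f b).map (fun r => evalAt r η) = hermiteAt f (evalHom η) b := by
  have hK := isUnit_algebraMap_lcProd hG
  have hH : hermite f b = hermiteAt f (algebraMap _ (ParamField t)) b := rfl
  rw [hH, ← map_hermiteCoeff hG hK hfin, ← map_hermiteCoeff hG (isUnit_evalHom_lcProd hη) hfin]
  ext i j
  exact (definedAt_lift hK hη _).2

lemma minors_definedAt_and_evalAt
    (hG : IsReducedGroebnerBasis (elimOrder n t) G (Ideal.span (Set.range f)))
    (hfin : (standardMonomials G).Finite) (b : Fin δ → (Fin n →₀ ℕ)) (A : GL (Fin δ) ℚ)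
    {η : Fin t → ℝ} (hη : (aeval η (lcProd G) : ℝ) ≠ 0) (i : Fin δ) :
    DefinedAt (minors (hermite f b) A i) η ∧ evalAt (minors (hermite f b) A i) η =
      leadingMinor (((A : Matrix (Fin δ) (Fin δ) ℚ).map (algebraMap ℚ ℝ)).transpose *
        hermiteAt f (evalHom η) b * (A : Matrix (Fin δ) (Fin δ) ℚ).map (algebraMap ℚ ℝ)) i := by
  have hK := isUnit_algebraMap_lcProd hG
  have hM : minors (hermite f b) A i = IsLocalization.Away.lift (lcProd G) hK
      (minorsCoeff f G b A i) := (lift_minorsCoeff hG hK hfin b A i).symm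
  rw [hM, ← lift_minorsCoeff hG (isUnit_evalHom_lcProd hη) hfin]
  exact definedAt_lift hK hη _

/-- The points of the real fibre are the real points of the specialized quotient algebra. -/
noncomputable def realFiberEquiv (f : Fin m → Poly n t) (η : Fin t → ℝ) :
    (MvPolynomial (Fin n) ℝ ⧸ systemIdeal f (evalHom η) →ₐ[ℝ] ℝ) ≃ realFiber f η where
  toFun g := ⟨fun i => g (Ideal.Quotient.mk _ (X i)), by
    refine (mem_zeroLocus_systemIdeal f η _).1 ?_
    rw [mem_zeroLocus_iff]
    intro p hp
    have h : aeval (fun i => g (Ideal.Quotient.mk _ (X i))) =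
        g.comp (Ideal.Quotient.mkₐ ℝ (systemIdeal f (evalHom η))) := by
      ext i
      rw [aeval_X]
      rfl
    rw [h, AlgHom.comp_apply, Ideal.Quotient.mkₐ_eq_mk, Ideal.Quotient.eq_zero_iff_mem.2 hp,
      map_zero]⟩
  invFun x := Ideal.Quotient.liftₐ _ (aeval (x : Fin n → ℝ))
    ((mem_zeroLocus_iff).1 ((mem_zeroLocus_systemIdeal f η x).2 x.2))
  left_inv g := by
    apply Ideal.Quotient.algHom_ext
    ext i
    exact aeval_X (fun i => g (Ideal.Quotient.mk _ (X i))) i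
  right_inv x := by
    ext i
    exact aeval_X (x : Fin n → ℝ) i

/-- Away from the zeros of the `x`-leading coefficients and of the minors, the number of real roots
is the signature of the specialized Hermite matrix. -/
theorem realFiber_finite_and_ncard
    (hG : IsReducedGroebnerBasis (elimOrder n t) G (Ideal.span (Set.range f)))
    (b : Fin δ ≃ standardMonomials G) {η : Fin t → ℝ} (hη : (aeval η (lcProd G) : ℝ) ≠ 0)
    (hdet : (hermiteAt f (evalHom η) (fun j => (b j : Fin n →₀ ℕ))).det ≠ 0) :
    (realFiber f η).Finite ∧ ((realFiber f η).ncard : ℤ) =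
      signature (hermiteAt f (evalHom η) (fun j => (b j : Fin n →₀ ℕ))) := by
  obtain ⟨β, hβ⟩ := exists_basis_coeffRing hG
  obtain ⟨γ, hγ, -⟩ := exists_basis_systemIdeal hG β hβ (isUnit_evalHom_lcProd hη)
  have hH := hermiteAt_eq_traceMatrix b hγ
  rw [hH] at hdet ⊢
  -- The specialized ideal need not be radical a priori; nonsingularity of the matrix at `η`
  -- supplies reducedness.
  have := isReduced_of_traceMatrix_det_ne_zero _ hdet
  have := Module.Finite.of_basis (γ.reindex b.symm)
  obtain ⟨h1, h2⟩ := signature_trace_eq_card (γ.reindex b.symm)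
  refine ⟨Set.finite_coe_iff.1 (Finite.of_equiv _ (realFiberEquiv f η)), ?_⟩
  rw [← Nat.card_coe_set_eq, ← Nat.card_congr (realFiberEquiv f η), ← h2]
  rfl

lemma det_ne_zero_of_leadingMinor_ne_zero {k : Type} [CommRing k] [Nontrivial k]
    {S : Matrix (Fin δ) (Fin δ) k} (h : ∀ i, leadingMinor S i ≠ 0) : S.det ≠ 0 := by
  cases δ with
  | zero => simp
  | succ δ => exact h (Fin.last δ)

/-- The number of real roots is determined by the signs of the minors. -/
theorem realFiber_eq_of_sign_eq
    (hG : IsReducedGroebnerBasis (elimOrder n t) G (Ideal.span (Set.range f)))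
    (hfin : (standardMonomials G).Finite)
    (b : Fin δ ≃ standardMonomials G) (A : GL (Fin δ) ℚ) {η : Fin t → ℝ}
    (hη : (aeval η (lcProd G) : ℝ) ≠ 0)
    (h0 : ∀ i, evalAt (minors (hermite f (fun j => (b j : Fin n →₀ ℕ))) A i) η ≠ 0) :
    (realFiber f η).Finite ∧
    ((realFiber f η).ncard : ℤ) = signature
      ((hermite f (fun j => (b j : Fin n →₀ ℕ))).map (fun r => evalAt r η)) ∧
    ∀ η' : Fin t → ℝ, (aeval η' (lcProd G) : ℝ) ≠ 0 →
      (∀ i, SignType.sign (evalAt (minors (hermite f (fun j => (b j : Fin n →₀ ℕ))) A i) η) =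
        SignType.sign (evalAt (minors (hermite f (fun j => (b j : Fin n →₀ ℕ))) A i) η')) →
      (realFiber f η').Finite ∧ (realFiber f η).ncard = (realFiber f η').ncard := by
  set b' : Fin δ → (Fin n →₀ ℕ) := fun j => (b j : Fin n →₀ ℕ)
  let P := (A : Matrix (Fin δ) (Fin δ) ℚ).map (algebraMap ℚ ℝ)
  have hP : IsUnit P.det := by
    have h : P.det = algebraMap ℚ ℝ (A : Matrix (Fin δ) (Fin δ) ℚ).det :=
      ((algebraMap ℚ ℝ).map_det _).symm
    rw [h]
    exact ((Matrix.isUnit_iff_isUnit_det _).1 A.isUnit).map _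
  have key : ∀ η : Fin t → ℝ, (aeval η (lcProd G) : ℝ) ≠ 0 →
      (∀ i, evalAt (minors (hermite f b') A i) η ≠ 0) →
      (realFiber f η).Finite ∧ ((realFiber f η).ncard : ℤ) =
        signature (P.transpose * hermiteAt f (evalHom η) b' * P) := by
    intro η hη h0
    simp only [(minors_definedAt_and_evalAt hG hfin b' A hη _).2] at h0
    have hdet := det_ne_zero_of_leadingMinor_ne_zero h0
    rw [Matrix.det_mul, Matrix.det_mul] at hdet
    have hfc := realFiber_finite_and_ncard hG b hη
      (right_ne_zero_of_mul (left_ne_zero_of_mul hdet))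
    rwa [signature_transpose_mul_mul _ _ hP]
  have hη₁ := key η hη h0
  refine ⟨hη₁.1, ?_, fun η' hη' hs => ?_⟩
  · rw [hermite_map_evalAt hG hfin b' hη, hη₁.2, signature_transpose_mul_mul _ _ hP]
  have h0' : ∀ i, evalAt (minors (hermite f b') A i) η' ≠ 0 := fun i => by
    rw [← sign_ne_zero, ← hs, sign_ne_zero]
    exact h0 i
  have hη₂ := key η' hη' h0'
  refine ⟨hη₂.1, ?_⟩
  have hsymm : ∀ η : Fin t → ℝ, (P.transpose * hermiteAt f (evalHom η) b' * P).IsSymm := by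
    intro η
    rw [Matrix.IsSymm, Matrix.transpose_mul, Matrix.transpose_mul, Matrix.transpose_transpose,
      (hermiteAt_isSymm _ _).eq, Matrix.mul_assoc]
  have hsig := signature_eq_of_sign_leadingMinor_eq (hsymm η) (hsymm η')
    (fun i => by
      rw [← (minors_definedAt_and_evalAt hG hfin b' A hη i).2]
      exact h0 i)
    (fun i => by
      rw [← (minors_definedAt_and_evalAt hG hfin b' A hη i).2,
        ← (minors_definedAt_and_evalAt hG hfin b' A hη' i).2]
      exact hs i)
  rw [← Nat.cast_inj (R := ℤ), hη₁.2, hη₂.2, hsig]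

end Evaluation

end RRC

namespace RRC

open MvPolynomial

/-! ### Sample points and real root classification -/

section Classification

variable {t n m δ : ℕ} {f : Fin m → Poly n t} {G : Finset (Poly n t)}

lemma dvd_lcProd {g : Poly n t} (hg : g ∈ G) : lcX g ∣ lcProd G := Finset.dvd_prod_of_mem lcX hg

lemma aeval_lcProd_ne_zero_iff {η : Fin t → ℝ} :
    (aeval η (lcProd G) : ℝ) ≠ 0 ↔ η ∉ Winf G := by
  rw [lcProd, map_prod, Finset.prod_ne_zero_iff, Winf]
  simp

/-- Each `lcX g` divides a power of the radical of the lcm, and that radical divides `lcProd G`; so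
the zero sets agree. -/
lemma aeval_winf_ne_zero_iff
    (hG : IsReducedGroebnerBasis (elimOrder n t) G (Ideal.span (Set.range f))) {η : Fin t → ℝ} :
    (aeval η (winf G) : ℝ) ≠ 0 ↔ (aeval η (lcProd G) : ℝ) ≠ 0 := by
  let : NormalizedGCDMonoid (ParamPoly t) := Nonempty.some inferInstance
  have hw : winf G = UniqueFactorizationMonoid.radical (G.lcm lcX) := rfl
  have hdvd : G.lcm lcX ∣ lcProd G := Finset.lcm_dvd fun g hg => dvd_lcProd hg
  constructor
  · intro h h0
    rw [← not_ne_iff, aeval_lcProd_ne_zero_iff, not_not] at h0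
    obtain ⟨g, hg, hg0⟩ := h0
    have hne : G.lcm lcX ≠ 0 := ne_zero_of_dvd_ne_zero (lcProd_ne_zero hG) hdvd
    obtain ⟨N, hN⟩ := UniqueFactorizationMonoid.exists_dvd_radical_self_pow hne
    obtain ⟨c, hc⟩ := (Finset.dvd_lcm hg).trans hN
    have hc' := congrArg (aeval η : ParamPoly t →ₐ[ℚ] ℝ) hc
    rw [← hw, map_pow, map_mul, hg0, zero_mul] at hc'
    exact h (eq_zero_of_pow_eq_zero hc')
  · intro h h0
    obtain ⟨c, hc⟩ := UniqueFactorizationMonoid.radical_dvd_self.trans hdvd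
    rw [hc, map_mul, ← hw, h0, zero_mul] at h
    exact h rfl

lemma sign_evalAt {r : ParamField t} {η : Fin t → ℝ} (h : DefinedAt r η) :
    SignType.sign (evalAt r η) = SignType.sign (aeval η (IsFractionRing.num (ParamPoly t) r *
      (IsFractionRing.den (ParamPoly t) r : ParamPoly t)) : ℝ) := by
  rw [map_mul, evalAt, div_eq_mul_inv, sign_mul, sign_mul]
  congr 1
  rcases lt_or_gt_of_ne h with h | h
  · rw [sign_neg h, sign_neg (inv_lt_zero.2 h)]
  · rw [sign_pos h, sign_pos (inv_pos.2 h)]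

lemma definedAt_and_evalAt_ne_zero_iff {r : ParamField t} {η : Fin t → ℝ} :
    DefinedAt r η ∧ evalAt r η ≠ 0 ↔ (aeval η (IsFractionRing.num (ParamPoly t) r *
      (IsFractionRing.den (ParamPoly t) r : ParamPoly t)) : ℝ) ≠ 0 := by
  rw [map_mul, evalAt, DefinedAt]
  constructor
  · rintro ⟨h1, h2⟩
    exact mul_ne_zero (div_ne_zero_iff.1 h2).1 h1
  · intro h
    exact ⟨right_ne_zero_of_mul h, div_ne_zero (left_ne_zero_of_mul h) (right_ne_zero_of_mul h)⟩

lemma aeval_eq_eval_map (η : Fin t → ℝ) (p : ParamPoly t) :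
    (aeval η p : ℝ) = eval η (map (algebraMap ℚ ℝ) p) := by
  rw [eval_map, aeval_def]

lemma sign_eq_of_isPreconnected {X : Type*} [TopologicalSpace X] {C : Set X}
    (hC : IsPreconnected C) {u : X → ℝ} (hu : Continuous u) (h0 : ∀ x ∈ C, u x ≠ 0) {x y : X}
    (hx : x ∈ C) (hy : y ∈ C) : SignType.sign (u x) = SignType.sign (u y) := by
  have key : ∀ x ∈ C, ∀ y ∈ C, u x < 0 → ¬ 0 < u y := by
    intro x hx y hy hlt hgt
    obtain ⟨z, hz, hz0⟩ := hC.intermediate_value hx hy hu.continuousOn ⟨hlt.le, hgt.le⟩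
    exact h0 z hz hz0
  rcases lt_or_gt_of_ne (h0 x hx) with h | h <;> rcases lt_or_gt_of_ne (h0 y hy) with h' | h'
  · rw [sign_neg h, sign_neg h']
  · exact absurd h' (key x hx y hy h)
  · exact absurd h (key y hy x hx h')
  · rw [sign_pos h, sign_pos h']

/-- The polynomial whose nonvanishing defines the set to be sampled. -/
noncomputable def samplePoly (w : ParamPoly t) (M : Fin δ → ParamField t) : ParamPoly t :=
  w * ∏ i, (IsFractionRing.num (ParamPoly t) (M i) *
    (IsFractionRing.den (ParamPoly t) (M i) : ParamPoly t))

lemma sampleSet_eq (w : ParamPoly t) (M : Fin δ → ParamField t) :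
    {η : Fin t → ℝ | (aeval η w : ℝ) ≠ 0 ∧ η ∈ nonvanishing M} =
      {η | eval η (map (algebraMap ℚ ℝ) (samplePoly w M)) ≠ 0} := by
  ext η
  simp only [Set.mem_ofPred_eq]
  rw [← aeval_eq_eval_map, samplePoly, map_mul, map_prod, mul_ne_zero_iff, Finset.prod_ne_zero_iff]
  refine and_congr_right fun _ => ⟨fun h i _ => definedAt_and_evalAt_ne_zero_iff.1 (h i),
    fun h i => definedAt_and_evalAt_ne_zero_iff.2 (h i (Finset.mem_univ i))⟩

lemma denseRange_toReal : DenseRange (toReal : (Fin t → ℚ) → Fin t → ℝ) :=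
  DenseRange.piMap fun _ => Rat.denseRange_cast

/-- Components of an open set are open, so each representative can be replaced by a rational point
of its component. -/
theorem exists_isSamplePoints {U : Set (Fin t → ℝ)} (hU : IsOpen U)
    (hfin : FinitelyManyComponents U) : ∃ L, IsSamplePoints U L := by
  classical
  obtain ⟨F, hF⟩ := hfin
  have h : ∀ q : Fin t → ℝ, ∃ η : Fin t → ℚ, q ∈ U → toReal η ∈ connectedComponentIn U q := by
    intro q
    by_cases hq : q ∈ U
    · obtain ⟨η, hη⟩ := denseRange_toReal.exists_mem_open hU.connectedComponentIn
        ⟨q, mem_connectedComponentIn hq⟩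
      exact ⟨η, fun _ => hη⟩
    · exact ⟨0, fun h => absurd h hq⟩
  choose e he using h
  refine ⟨(F.filter (· ∈ U)).image e, fun η hη => ?_, fun p hp => ?_⟩
  · obtain ⟨q, hq, rfl⟩ := Finset.mem_image.1 hη
    exact connectedComponentIn_subset _ _ (he q (Finset.mem_filter.1 hq).2)
  · obtain ⟨q, hqF, hq⟩ := hF p hp
    have hqU := connectedComponentIn_subset _ _ hq
    refine ⟨e q, Finset.mem_image_of_mem _ (Finset.mem_filter.2 ⟨hqF, hqU⟩), ?_⟩
    rw [connectedComponentIn_eq hq]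
    exact he q hqU

/-- The sign is that of the polynomial numerator times denominator, continuous and nonvanishing on
`U`. Only the reduced fraction matters, so a component may cross `𝒲_∞` without a change of sign. -/
lemma sign_eq_of_mem_connectedComponentIn {U : Set (Fin t → ℝ)} {r : ParamField t}
    (hU : ∀ η ∈ U, DefinedAt r η ∧ evalAt r η ≠ 0) {p η η' : Fin t → ℝ}
    (hη : η ∈ connectedComponentIn U p) (hη' : η' ∈ connectedComponentIn U p) :
    SignType.sign (evalAt r η) = SignType.sign (evalAt r η') := by
  have hsub := connectedComponentIn_subset U p
  rw [sign_evalAt (hU η (hsub hη)).1, sign_evalAt (hU η' (hsub hη')).1, aeval_eq_eval_map,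
    aeval_eq_eval_map]
  refine sign_eq_of_isPreconnected isPreconnected_connectedComponentIn
    (MvPolynomial.continuous_eval _) (fun x hx => ?_) hη hη'
  rw [← aeval_eq_eval_map]
  exact definedAt_and_evalAt_ne_zero_iff.1 (hU x (hsub hx))

lemma mem_signFormula_toSet {w : ParamPoly t} {M : Fin δ → ParamField t} {η₀ η : Fin t → ℝ} :
    η ∈ (signFormula w M η₀).toSet ↔ (aeval η w : ℝ) ≠ 0 ∧
      ∀ i, SignType.sign (aeval η (IsFractionRing.num (ParamPoly t) (M i) *
        (IsFractionRing.den (ParamPoly t) (M i) : ParamPoly t)) : ℝ) =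
          SignType.sign (evalAt (M i) η₀) := by
  have hw : SignType.sign (aeval η (w ^ 2) : ℝ) = 1 ↔ (aeval η w : ℝ) ≠ 0 := by
    rw [map_pow, sign_eq_one_iff, sq_pos_iff]
  simp only [SAFormula.toSet, signFormula, Set.mem_ofPred_eq, List.mem_singleton, exists_eq_left,
    List.forall_mem_cons, List.forall_mem_ofFn_iff, hw]

lemma mem_signFormula_toSet_iff {w : ParamPoly t} {M : Fin δ → ParamField t} {η₀ η : Fin t → ℝ}
    (h₀ : η₀ ∈ nonvanishing M) :
    η ∈ (signFormula w M η₀).toSet ↔ (aeval η w : ℝ) ≠ 0 ∧ η ∈ nonvanishing M ∧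
      ∀ i, SignType.sign (evalAt (M i) η) = SignType.sign (evalAt (M i) η₀) := by
  rw [mem_signFormula_toSet]
  refine and_congr_right fun _ => ⟨fun h => ?_, fun h i => ?_⟩
  · have hn : η ∈ nonvanishing M := fun i => by
      refine definedAt_and_evalAt_ne_zero_iff.2 ?_
      rw [← sign_ne_zero, h i, sign_ne_zero]
      exact (h₀ i).2
    exact ⟨hn, fun i => by rw [sign_evalAt (hn i).1, h i]⟩
  · rw [← sign_evalAt (h.1 i).1, h.2 i]

lemma samplePoly_ne_zero {w : ParamPoly t} {M : Fin δ → ParamField t} (hw : w ≠ 0)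
    (hM : ∀ i, M i ≠ 0) : map (algebraMap ℚ ℝ) (samplePoly w M) ≠ 0 := by
  rw [ne_eq, map_eq_zero_iff _ (map_injective _ (algebraMap ℚ ℝ).injective), ← ne_eq, samplePoly,
    mul_ne_zero_iff, Finset.prod_ne_zero_iff]
  refine ⟨hw, fun i _ => mul_ne_zero ?_ (nonZeroDivisors.coe_ne_zero _)⟩
  rw [ne_eq, IsFractionRing.num_eq_zero]
  exact hM i

/-- The generic Hermite matrix is the trace matrix of a reduced algebra, hence nonsingular. -/
theorem zariskiDenseGL_minors (hrad : (Ideal.span (Set.range f)).IsRadical)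
    (hG : IsReducedGroebnerBasis (elimOrder n t) G (Ideal.span (Set.range f)))
    (b : Fin δ ≃ standardMonomials G) :
    ZariskiDenseGL {A : GL (Fin δ) ℚ |
      ∀ i, minors (hermite f (fun j => (b j : Fin n →₀ ℕ))) A i ≠ 0} := by
  obtain ⟨β, hβ⟩ := exists_basis_coeffRing hG
  obtain ⟨γ, hγ, -⟩ := exists_basis_systemIdeal hG β hβ (isUnit_algebraMap_lcProd hG)
  have hred := isReduced_quotient_systemIdeal hrad (K := ParamField t)
  have hH : hermite f (fun j => (b j : Fin n →₀ ℕ)) =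
      Algebra.traceMatrix (ParamField t) (γ.reindex b.symm) := hermiteAt_eq_traceMatrix b hγ
  refine zariskiDenseGL_leadingMinor (hermiteAt_isSymm (algebraMap _ (ParamField t)) _) ?_
  rw [hH]
  exact traceMatrix_det_ne_zero _

/-- Any output of the algorithm solves the real root classification problem. -/
theorem solvesRRC_of_isRRCHermiteOutput
    (hG : IsReducedGroebnerBasis (elimOrder n t) G (Ideal.span (Set.range f)))
    (hfin : (standardMonomials G).Finite) (b : Fin δ ≃ standardMonomials G) (A : GL (Fin δ) ℚ)
    (hM : ∀ i, minors (hermite f (fun j => (b j : Fin n →₀ ℕ))) A i ≠ 0)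
    {out : Set (SAFormula t × (Fin t → ℚ) × ℤ)}
    (hout : IsRRCHermiteOutput f G (fun j => (b j : Fin n →₀ ℕ)) A out) : SolvesRRC f out := by
  obtain ⟨L, ⟨hLU, hL⟩, rfl⟩ := hout
  have hw0 : winf G ≠ 0 := by
    let : NormalizedGCDMonoid (ParamPoly t) := Nonempty.some inferInstance
    exact UniqueFactorizationMonoid.radical_ne_zero
  refine ⟨L.finite_toSet.image _, ?_, ?_⟩
  · rintro _ ⟨η₀, hη₀, rfl⟩
    obtain ⟨hw, hn⟩ := hLU η₀ hη₀
    have hlc := (aeval_winf_ne_zero_iff hG).1 hw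
    obtain ⟨h1, h2, h3⟩ := realFiber_eq_of_sign_eq hG hfin b A hlc fun i => (hn i).2
    have hconst : ∀ η ∈ (signFormula (winf G) (minors (hermite f fun j => (b j : Fin n →₀ ℕ)) A)
        (toReal η₀)).toSet, (realFiber f η).encard = (realFiber f (toReal η₀)).encard := by
      intro η hη
      obtain ⟨hηw, -, hηs⟩ := (mem_signFormula_toSet_iff hn).1 hη
      obtain ⟨h4, h5⟩ := h3 η ((aeval_winf_ne_zero_iff hG).1 hηw) fun i => (hηs i).symm
      rw [← h4.cast_ncard_eq, ← h1.cast_ncard_eq, h5]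
    exact ⟨fun η hη η' hη' => (hconst η hη).trans (hconst η' hη').symm,
      (mem_signFormula_toSet_iff hn).2 ⟨hw, hn, fun i => rfl⟩, h1, h2⟩
  · have hdense := dense_ne_zero (samplePoly_ne_zero hw0 hM)
    rw [← sampleSet_eq] at hdense
    -- Each point of the sampled set shares its component, hence all its signs, with some sample
    -- point.
    refine hdense.mono fun p hp => ?_
    obtain ⟨η₀, hη₀, hmem⟩ := hL p hp
    refine Set.mem_biUnion (Set.mem_image_of_mem _ hη₀) ?_
    refine (mem_signFormula_toSet_iff (hLU η₀ hη₀).2).2 ⟨hp.1, hp.2, fun i => ?_⟩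
    exact sign_eq_of_mem_connectedComponentIn (fun η hη => hη.2 i) (mem_connectedComponentIn hp)
      hmem

end Classification

end RRC

theorem mainTheorem6 {t n m : ℕ} (f : Fin m → RRC.Poly n t)
    (hA : RRC.AssumptionA f)
    (hrad : (Ideal.span (Set.range f)).IsRadical)
    (G : Finset (RRC.Poly n t))
    (hG : RRC.IsReducedGroebnerBasis (RRC.elimOrder n t) G (Ideal.span (Set.range f))) :
    (RRC.standardMonomials G).Finite ∧
    ∀ (δ : ℕ) (b : Fin δ ≃ RRC.standardMonomials G),
      RRC.ZariskiDenseGL {A : GL (Fin δ) ℚ |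
        ∀ i, RRC.minors (RRC.hermite f (fun j => (b j : Fin n →₀ ℕ))) A i ≠ 0} ∧
      ∀ A : GL (Fin δ) ℚ,
        (∀ i, RRC.minors (RRC.hermite f (fun j => (b j : Fin n →₀ ℕ))) A i ≠ 0) →
        (∀ p ∈ RRC.nonvanishing (RRC.minors (RRC.hermite f (fun j => (b j : Fin n →₀ ℕ))) A),
          ∀ η ∈ connectedComponentIn
              (RRC.nonvanishing
                (RRC.minors (RRC.hermite f (fun j => (b j : Fin n →₀ ℕ))) A)) p \ RRC.Winf G,
          ∀ η' ∈ connectedComponentIn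
              (RRC.nonvanishing
                (RRC.minors (RRC.hermite f (fun j => (b j : Fin n →₀ ℕ))) A)) p \ RRC.Winf G,
            (RRC.realFiber f η).Finite ∧
              (RRC.realFiber f η).ncard = (RRC.realFiber f η').ncard) ∧
        (∃ out, RRC.IsRRCHermiteOutput f G (fun j => (b j : Fin n →₀ ℕ)) A out) ∧
        ∀ out, RRC.IsRRCHermiteOutput f G (fun j => (b j : Fin n →₀ ℕ)) A out →
          RRC.SolvesRRC f out := by
  have hfin := RRC.finite_standardMonomials hA hG
  refine ⟨hfin, fun δ b => ⟨RRC.zariskiDenseGL_minors hrad hG b, fun A hM => ⟨?_, ?_, ?_⟩⟩⟩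
  · rintro p - η ⟨hη, hηW⟩ η' ⟨hη', hηW'⟩
    have hsub := connectedComponentIn_subset (RRC.nonvanishing
      (RRC.minors (RRC.hermite f (fun j => (b j : Fin n →₀ ℕ))) A)) p
    obtain ⟨h1, -, h2⟩ := RRC.realFiber_eq_of_sign_eq hG hfin b A
      (RRC.aeval_lcProd_ne_zero_iff.2 hηW) fun i => (hsub hη i).2
    exact ⟨h1, (h2 η' (RRC.aeval_lcProd_ne_zero_iff.2 hηW') fun i =>
      RRC.sign_eq_of_mem_connectedComponentIn (fun x (hx : x ∈ RRC.nonvanishing _) => hx i) hη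
        hη').2⟩
  · obtain ⟨L, hL⟩ := RRC.exists_isSamplePoints
      (U := {η | (MvPolynomial.aeval η (RRC.winf G) : ℝ) ≠ 0 ∧
        η ∈ RRC.nonvanishing (RRC.minors (RRC.hermite f fun j => (b j : Fin n →₀ ℕ)) A)})
      (by
        rw [RRC.sampleSet_eq]
        exact isOpen_ne_fun (MvPolynomial.continuous_eval _) continuous_const)
      (by
        rw [RRC.sampleSet_eq]
        exact RRC.finitelyManyComponents_ne_zero _)
    exact ⟨_, L, hL, rfl⟩
  · exact fun out hout => RRC.solvesRRC_of_isRRCHermiteOutput hG hfin b A hM hout
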